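/- Let $\mathbb K\in\{\mathbb R,\mathbb C\}$, let $X,U$ be Banach spaces over $\mathbb K$, and let $A$ generate a $C_0$-semigroup $(T(t))_{t\ge0}$ on $X$. Fix $\beta\in\rho(A)$, let $X_{-1}$ be the completion of $X$ for the norm $\|x\|_{X_{-1}}=\|(\beta-A)^{-1}x\|_X$, let $T_{-1}(t)$ be the continuous extension of $T(t)$ to $X_{-1}$, and let $B:U\to X_{-1}$ be linear and bounded. For $x_0\in X$ and $u\in L^1(0,t;U)$ put $$x(t)=T(t)x_0+\int_0^tT_{-1}(t-s)Bu(s)\,ds\in X_{-1},$$ the mild solution of the system $\Sigma(A,B)$: $\dot x=Ax+Bu$, $x(0)=x_0$. A Young function is a function $\Phi(t)=\int_0^t\varphi(s)\,ds$, $t\ge0$, where $\varphi:[0,\infty)\to\mathbb R$ is right-continuous and nondecreasing, $\varphi(0)=0$, $\varphi(s)>0$ for $s>0$ and $\varphi(s)\to\infty$ as $s\to\infty$. It satisfies the $\Delta_2$-condition if there are $k>0$, $u_0\ge0$ with $\Phi(2u)\le k\Phi(u)$ for all $u\ge u_0$. $L_\Phi(0,t;U)$ is the space of (classes of) strongly measurable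 $u:(0,t)\to U$ with $\int_0^t\Phi(\|u(s)\|/k)\,ds<\infty$ for some $k>0$, with the Luxemburg norm $\|u\|_\Phi=\inf\{k>0:\int_0^t\Phi(\|u(s)\|/k)\,ds\le1\}$, and $E_\Phi(0,t;U)$ is the closure of $L^\infty(0,t;U)$ in it. Let $\mathcal K$ be the set of continuous, strictly increasing $\mu:[0,\infty)\to[0,\infty)$ with $\mu(0)=0$; $\mathcal K_\infty$ the set of $\theta\in\mathcal K$ with $\theta(s)\to\infty$ as $s\to\infty$; and $\mathcal{KL}$ the set of $b:[0,\infty)^2\to[0,\infty)$ such that $b(\cdot,t)\in\mathcal K$ for all $t\ge0$ and, for all $s>0$, $b(s,\cdot)$ is continuous and strictly decreasing with limit $0$ at infinity. The system $\Sigma(A,B)$ is called * $E_\Phi$-ISS if there are $b\in\mathcal{KL}$, $\mu\in\mathcal K_\infty$ such that for all $t\ge0$, $x_0\in X$, $u\in E_\Phi(0,t;U)$: $x(t)\in X$ and $\|x(t)\|\le b(\|x_0\|,t)+\mu(\|u\|_\Phi)$; * $E_\Phi$-iISS if there are $b\in\mathcal{KL}$, $\theta\in\mathcal K_\infty$, $\mu\in\mathcal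 K$ such that for all such $t,x_0,u$: $x(t)\in X$ and $\|x(t)\|\le b(\|x_0\|,t)+\theta\bigl(\int_0^t\mu(\|u(s)\|)\,ds\bigr)$; * $E_\Phi$-UBEBS if there are $\gamma,\theta\in\mathcal K_\infty$, $\mu\in\mathcal K$ and $c>0$ such that for all such $t,x_0,u$: $x(t)\in X$ and $\|x(t)\|\le\gamma(\|x_0\|)+\theta\bigl(\int_0^t\mu(\|u(s)\|)\,ds\bigr)+c$, where the last two inequalities hold trivially if the integral is infinite. **Theorem.** If $\Phi$ is a Young function satisfying the $\Delta_2$-condition, then the following are equivalent: (i) $\Sigma(A,B)$ is $E_\Phi$-ISS; (ii) $\Sigma(A,B)$ is $E_\Phi$-iISS; (iii) $\Sigma(A,B)$ is $E_\Phi$-UBEBS and $(T(t))_{t\ge0}$ is exponentially stable, i.e. there are $M,\omega>0$ with $\|T(t)\|\le Me^{-\omega t}$ for all $t\ge0$. -/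

import Mathlib

open MeasureTheory Set Filter Topology
open scoped NNReal ENNReal

/-! ### Young functions and Orlicz spaces on `(0, t)` -/

/-- `Φ` (only its values on `[0, ∞)` matter) is a Young function: `Φ t = ∫₀ᵗ φ` with `φ`
right-continuous, nondecreasing, `φ 0 = 0`, positive on `(0, ∞)` and tending to infinity. -/
def IsYoungFunction (Φ : ℝ → ℝ) : Prop :=
  ∃ φ : ℝ → ℝ,
    (∀ s, 0 ≤ s → ContinuousWithinAt φ (Ici s) s) ∧
    MonotoneOn φ (Ici 0) ∧
    φ 0 = 0 ∧
    (∀ s, 0 < s → 0 < φ s) ∧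
    Tendsto φ atTop atTop ∧
    ∀ t, 0 ≤ t → Φ t = ∫ s in (0 : ℝ)..t, φ s

/-- The `Δ₂`-condition. -/
def SatisfiesDeltaTwo (Φ : ℝ → ℝ) : Prop :=
  ∃ k u₀ : ℝ, 0 < k ∧ 0 ≤ u₀ ∧ ∀ u, u₀ ≤ u → Φ (2 * u) ≤ k * Φ u

section Orlicz

variable {U : Type*} [NormedAddCommGroup U]

/-- The modular `∫₀ᵗ Φ (‖u s‖ / k) ds`, a number in `[0, ∞]`. -/
noncomputable def orliczModular (Φ : ℝ → ℝ) (t : ℝ≥0) (k : ℝ) (u : ℝ → U) : ℝ≥0∞ :=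
  ∫⁻ s in Ioo (0 : ℝ) t, ENNReal.ofReal (Φ (k⁻¹ * ‖u s‖))

/-- `u` represents an element of the Orlicz space `L_Φ(0, t; U)`. -/
def MemOrliczL (Φ : ℝ → ℝ) (t : ℝ≥0) (u : ℝ → U) : Prop :=
  AEStronglyMeasurable u (volume.restrict (Ioo (0 : ℝ) t)) ∧
    ∃ k : ℝ, 0 < k ∧ orliczModular Φ t k u < ∞

/-- The Luxemburg norm on `L_Φ(0, t; U)`. -/
noncomputable def luxemburgNorm (Φ : ℝ → ℝ) (t : ℝ≥0) (u : ℝ → U) : ℝ≥0 :=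
  (sInf {k : ℝ | 0 < k ∧ orliczModular Φ t k u ≤ 1}).toNNReal

/-- `u` represents an element of `E_Φ(0, t; U)`, the closure of `L^∞(0, t; U)` in
`L_Φ(0, t; U)` with respect to the Luxemburg norm. -/
def MemOrliczE (Φ : ℝ → ℝ) (t : ℝ≥0) (u : ℝ → U) : Prop :=
  MemOrliczL Φ t u ∧
    ∀ ε : ℝ≥0, 0 < ε → ∃ v : ℝ → U,
      MemLp v ∞ (volume.restrict (Ioo (0 : ℝ) t)) ∧ luxemburgNorm Φ t (u - v) < ε

end Orlicz

/-! ### Comparison functions -/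

/-- The class `𝒦`. -/
def IsClassK (μ : ℝ≥0 → ℝ≥0) : Prop :=
  μ 0 = 0 ∧ Continuous μ ∧ StrictMono μ

/-- The class `𝒦_∞`. -/
def IsClassKInfty (θ : ℝ≥0 → ℝ≥0) : Prop :=
  IsClassK θ ∧ Tendsto θ atTop atTop

/-- The class `ℒ`. -/
def IsClassL (γ : ℝ≥0 → ℝ≥0) : Prop :=
  Continuous γ ∧ StrictAnti γ ∧ Tendsto γ atTop (𝓝 0)

/-- The class `𝒦ℒ`. -/
def IsClassKL (β : ℝ≥0 → ℝ≥0 → ℝ≥0) : Prop :=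
  (∀ t, IsClassK fun s => β s t) ∧ ∀ s, 0 < s → IsClassL (β s)

/-! ### Strongly continuous semigroups and their generators -/

/-- A `C₀`-semigroup of bounded operators on `X`. -/
structure C0Semigroup (𝕜 X : Type*) [RCLike 𝕜] [NormedAddCommGroup X] [NormedSpace 𝕜 X] where
  /-- The operator at time `t`. -/
  op : ℝ≥0 → X →L[𝕜] X
  op_zero : op 0 = ContinuousLinearMap.id 𝕜 X
  op_add : ∀ s t, op (s + t) = (op s).comp (op t)
  continuous_orbit : ∀ x, Continuous fun t => op t x

namespace C0Semigroup

variable {𝕜 X : Type*} [RCLike 𝕜] [NormedAddCommGroup X] [NormedSpace 𝕜 X]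

/-- The difference quotient `h⁻¹ (T(h) x - x)`. -/
noncomputable def diffQuot (T : C0Semigroup 𝕜 X) (x : X) (h : ℝ≥0) : X :=
  (((h : ℝ) : 𝕜)⁻¹) • (T.op h x - x)

/-- `x` belongs to the domain of the generator and the generator maps it to `y`. -/
def GeneratorRel (T : C0Semigroup 𝕜 X) (x y : X) : Prop :=
  Tendsto (T.diffQuot x) (𝓝[>] 0) (𝓝 y)

theorem GeneratorRel.add {T : C0Semigroup 𝕜 X} {x y x' y' : X} (h : T.GeneratorRel x y)
    (h' : T.GeneratorRel x' y') : T.GeneratorRel (x + x') (y + y') := by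
  refine (Tendsto.add h h').congr fun r => ?_
  simp only [diffQuot, map_add, ← smul_add]
  congr 1
  abel

theorem GeneratorRel.smul {T : C0Semigroup 𝕜 X} {x y : X} (c : 𝕜) (h : T.GeneratorRel x y) :
    T.GeneratorRel (c • x) (c • y) := by
  refine (Tendsto.const_smul h c).congr fun r => ?_
  simp only [diffQuot, map_smul, ← smul_sub]
  exact smul_comm _ _ _

theorem GeneratorRel.zero (T : C0Semigroup 𝕜 X) : T.GeneratorRel 0 0 := by
  have h : T.diffQuot 0 = fun _ => 0 := by
    funext r
    simp [diffQuot]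
  simp [GeneratorRel, h]

theorem GeneratorRel.unique {T : C0Semigroup 𝕜 X} {x y z : X} (h : T.GeneratorRel x y)
    (h' : T.GeneratorRel x z) : y = z :=
  tendsto_nhds_unique h h'

theorem GeneratorRel.map {T : C0Semigroup 𝕜 X} {x y : X} (t : ℝ≥0) (h : T.GeneratorRel x y) :
    T.GeneratorRel (T.op t x) (T.op t y) := by
  refine (((T.op t).continuous.tendsto y).comp h).congr fun r => ?_
  have hc : T.op t (T.op r x) = T.op r (T.op t x) := by
    have h1 := T.op_add t r
    rw [add_comm, T.op_add r t] at h1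
    exact (DFunLike.congr_fun h1 x).symm
  simp [diffQuot, hc]

/-- The generator `A` of the semigroup, with its natural domain, as an unbounded operator. -/
noncomputable def generator (T : C0Semigroup 𝕜 X) : X →ₗ.[𝕜] X where
  domain :=
    { carrier := {x | ∃ y, T.GeneratorRel x y}
      add_mem' := fun ⟨y, hy⟩ ⟨z, hz⟩ => ⟨y + z, hy.add hz⟩
      zero_mem' := ⟨0, GeneratorRel.zero T⟩
      smul_mem' := fun c _ ⟨y, hy⟩ => ⟨c • y, hy.smul c⟩ }
  toFun :=
    { toFun := fun x => x.2.choose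
      map_add' := fun x x' => (x + x').2.choose_spec.unique
        (x.2.choose_spec.add x'.2.choose_spec)
      map_smul' := fun c x => (c • x).2.choose_spec.unique (x.2.choose_spec.smul c) }

theorem generatorRel_generator (T : C0Semigroup 𝕜 X) (x : T.generator.domain) :
    T.GeneratorRel x (T.generator x) :=
  x.2.choose_spec

theorem generator_eq (T : C0Semigroup 𝕜 X) {x y : X} (h : T.GeneratorRel x y) :
    T.generator ⟨x, y, h⟩ = y :=
  (T.generatorRel_generator ⟨x, y, h⟩).unique h

/-- `R` is the inverse `(β - A)⁻¹` of `β - A : D(A) → X`. -/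
def IsResolventAt (T : C0Semigroup 𝕜 X) (β : 𝕜) (R : X →L[𝕜] X) : Prop :=
  (∀ x, ∃ h : R x ∈ T.generator.domain, β • R x - T.generator ⟨R x, h⟩ = x) ∧
    ∀ x : T.generator.domain, R (β • (x : X) - T.generator x) = x

/-- The resolvent set `ρ(A)` of the generator. -/
def generatorResolventSet (T : C0Semigroup 𝕜 X) : Set 𝕜 :=
  {β | ∃ R : X →L[𝕜] X, T.IsResolventAt β R}

/-- The resolvent `(β - A)⁻¹`. -/
noncomputable def resolventOp (T : C0Semigroup 𝕜 X) (β : T.generatorResolventSet) : X →L[𝕜] X :=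
  β.2.choose

theorem isResolventAt_resolventOp (T : C0Semigroup 𝕜 X) (β : T.generatorResolventSet) :
    T.IsResolventAt β (T.resolventOp β) :=
  β.2.choose_spec

theorem resolventOp_injective (T : C0Semigroup 𝕜 X) (β : T.generatorResolventSet) :
    Function.Injective (T.resolventOp β) := by
  rw [injective_iff_map_eq_zero]
  intro x hx
  obtain ⟨h, hR⟩ := (T.isResolventAt_resolventOp β).1 x
  have h0 : (⟨T.resolventOp β x, h⟩ : T.generator.domain) = 0 := Subtype.ext hx
  rw [h0, hx] at hR
  simpa using hR.symm

theorem resolventOp_comm (T : C0Semigroup 𝕜 X) (β : T.generatorResolventSet) (t : ℝ≥0) (x : X) :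
    T.resolventOp β (T.op t x) = T.op t (T.resolventOp β x) := by
  obtain ⟨h, hR⟩ := (T.isResolventAt_resolventOp β).1 x
  have hm := (T.generatorRel_generator ⟨_, h⟩).map t
  have h2 := (T.isResolventAt_resolventOp β).2 ⟨_, _, hm⟩
  rw [T.generator_eq hm] at h2
  have h3 : (β : 𝕜) • T.op t (T.resolventOp β x) -
      T.op t (T.generator ⟨T.resolventOp β x, h⟩) = T.op t x := by
    rw [← map_smul, ← map_sub, hR]
  simpa only [h3] using h2

/-- Exponential stability. -/
def IsExponentiallyStable (T : C0Semigroup 𝕜 X) : Prop :=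
  ∃ M ω : ℝ, 0 < M ∧ 0 < ω ∧ ∀ t : ℝ≥0, ‖T.op t‖ ≤ M * Real.exp (-ω * t)

/-! ### The extrapolation space -/

/-- The vector space `X`, to be normed by `‖x‖₋₁ = ‖(β - A)⁻¹ x‖`. -/
def PreExtrapolation (_T : C0Semigroup 𝕜 X) (_β : _T.generatorResolventSet) : Type _ := X

section Extrapolation

variable (T : C0Semigroup 𝕜 X) (β : T.generatorResolventSet)

noncomputable instance : AddCommGroup (T.PreExtrapolation β) :=
  inferInstanceAs (AddCommGroup X)

noncomputable instance : Module 𝕜 (T.PreExtrapolation β) :=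
  inferInstanceAs (Module 𝕜 X)

/-- The identity of `X`, as a map to `X` with the norm `‖·‖₋₁`. -/
def toPre : X ≃ₗ[𝕜] T.PreExtrapolation β := LinearEquiv.refl 𝕜 X

/-- The resolvent as a linear map on `X` with the norm `‖·‖₋₁`. -/
noncomputable def preResolvent : T.PreExtrapolation β →ₗ[𝕜] X :=
  (T.resolventOp β : X →ₗ[𝕜] X) ∘ₗ ((T.toPre β).symm : T.PreExtrapolation β →ₗ[𝕜] X)

noncomputable instance : NormedAddCommGroup (T.PreExtrapolation β) :=
  NormedAddCommGroup.induced (T.PreExtrapolation β) X (T.preResolvent β)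
    ((T.resolventOp_injective β).comp (T.toPre β).symm.injective)

noncomputable instance : NormedSpace 𝕜 (T.PreExtrapolation β) :=
  NormedSpace.induced 𝕜 (T.PreExtrapolation β) X (T.preResolvent β)

theorem norm_toPre (x : X) : ‖T.toPre β x‖ = ‖T.resolventOp β x‖ := rfl

/-- The extrapolation space `X₋₁`: the completion of `X` for `‖x‖₋₁ = ‖(β - A)⁻¹ x‖`. -/
abbrev Extrapolation : Type _ := UniformSpace.Completion (T.PreExtrapolation β)

noncomputable instance : NormedSpace ℝ (T.PreExtrapolation β) :=
  NormedSpace.restrictScalars ℝ 𝕜 (T.PreExtrapolation β)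

/-- The canonical embedding `X → X₋₁`. -/
noncomputable def embed : X →L[𝕜] T.Extrapolation β :=
  UniformSpace.Completion.toComplL.comp
    ((T.toPre β : X →ₗ[𝕜] T.PreExtrapolation β).mkContinuous ‖T.resolventOp β‖
      fun x => (T.resolventOp β).le_opNorm x)

theorem norm_embed (x : X) : ‖T.embed β x‖ = ‖T.resolventOp β x‖ :=
  UniformSpace.Completion.norm_coe (T.toPre β x)

/-- `T(t)` as a bounded operator for the norm `‖·‖₋₁`. -/
noncomputable def preOp (t : ℝ≥0) : T.PreExtrapolation β →L[𝕜] T.PreExtrapolation β :=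
  ((T.toPre β : X →ₗ[𝕜] T.PreExtrapolation β) ∘ₗ (T.op t : X →ₗ[𝕜] X) ∘ₗ
    ((T.toPre β).symm : T.PreExtrapolation β →ₗ[𝕜] X)).mkContinuous ‖T.op t‖ fun x => by
      have h := T.resolventOp_comm β t ((T.toPre β).symm x)
      change ‖T.resolventOp β (T.op t ((T.toPre β).symm x))‖ ≤
        ‖T.op t‖ * ‖T.resolventOp β ((T.toPre β).symm x)‖
      rw [h]
      exact (T.op t).le_opNorm _

/-- The operator `T₋₁(t)` on `X₋₁`, the unique continuous extension of `T(t)`. -/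
noncomputable def extrapolatedOp (t : ℝ≥0) : T.Extrapolation β →L[𝕜] T.Extrapolation β :=
  (T.preOp β t).completion

theorem extrapolatedOp_embed (t : ℝ≥0) (x : X) :
    T.extrapolatedOp β t (T.embed β x) = T.embed β (T.op t x) := by
  exact UniformSpace.Completion.map_coe (T.preOp β t).uniformContinuous (T.toPre β x)

end Extrapolation

/-! ### The system `ẋ = A x + B u` and its stability notions -/

section System

variable {U : Type*} [NormedAddCommGroup U] [NormedSpace 𝕜 U]
variable (T : C0Semigroup 𝕜 X) (β : T.generatorResolventSet) (B : U →L[𝕜] T.Extrapolation β)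

/-- The mild solution at time `t`, an element of `X₋₁`:
`x(t) = T(t) x₀ + ∫₀ᵗ T₋₁(t - s) B u(s) ds`. -/
noncomputable def mildSolution (x₀ : X) (u : ℝ → U) (t : ℝ≥0) : T.Extrapolation β :=
  T.embed β (T.op t x₀) +
    ∫ s in (0 : ℝ)..t, T.extrapolatedOp β ((t : ℝ) - s).toNNReal (B (u s))

/-- `E_Φ`-input-to-state stability. The mild solution lies in `X` exactly when it is the image
of some (unique) `x : X` under the embedding. -/
def IsOrliczISS (Φ : ℝ → ℝ) : Prop :=
  ∃ (b : ℝ≥0 → ℝ≥0 → ℝ≥0) (μ : ℝ≥0 → ℝ≥0), IsClassKL b ∧ IsClassKInfty μ ∧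
    ∀ (t : ℝ≥0) (x₀ : X) (u : ℝ → U), MemOrliczE Φ t u →
      ∃ x : X, T.embed β x = T.mildSolution β B x₀ u t ∧
        ‖x‖₊ ≤ b ‖x₀‖₊ t + μ (luxemburgNorm Φ t u)

/-- `E_Φ`-integral input-to-state stability. When the integral is infinite the estimate is
void, but the mild solution still has to lie in `X`. -/
def IsOrliczIISS (Φ : ℝ → ℝ) : Prop :=
  ∃ (b : ℝ≥0 → ℝ≥0 → ℝ≥0) (θ μ : ℝ≥0 → ℝ≥0), IsClassKL b ∧ IsClassKInfty θ ∧ IsClassK μ ∧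
    ∀ (t : ℝ≥0) (x₀ : X) (u : ℝ → U), MemOrliczE Φ t u →
      ∃ x : X, T.embed β x = T.mildSolution β B x₀ u t ∧
        (∫⁻ s in Ioo (0 : ℝ) t, (μ ‖u s‖₊ : ℝ≥0∞) < ∞ →
          ‖x‖₊ ≤ b ‖x₀‖₊ t + θ (∫⁻ s in Ioo (0 : ℝ) t, (μ ‖u s‖₊ : ℝ≥0∞)).toNNReal)

/-- The `E_Φ`-uniformly bounded energy bounded state property. -/
def IsOrliczUBEBS (Φ : ℝ → ℝ) : Prop :=
  ∃ (γ θ μ : ℝ≥0 → ℝ≥0) (c : ℝ≥0), IsClassKInfty γ ∧ IsClassKInfty θ ∧ IsClassK μ ∧ 0 < c ∧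
    ∀ (t : ℝ≥0) (x₀ : X) (u : ℝ → U), MemOrliczE Φ t u →
      ∃ x : X, T.embed β x = T.mildSolution β B x₀ u t ∧
        (∫⁻ s in Ioo (0 : ℝ) t, (μ ‖u s‖₊ : ℝ≥0∞) < ∞ →
          ‖x‖₊ ≤ γ ‖x₀‖₊ + θ (∫⁻ s in Ioo (0 : ℝ) t, (μ ‖u s‖₊ : ℝ≥0∞)).toNNReal + c)

end System

end C0Semigroup

/-! The argument runs (i) ⇒ (ii) ⇒ (iii) ⇒ (i).

(i) ⇒ (ii): the Luxemburg norm is dominated by a `𝒦_∞` function of `∫ μ(‖u‖)` with `μ(s) = Φ(s) +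
Φ(√s)`. By `Δ₂` this gauge dominates every dilation `Φ(2ⁿ s)` up to a constant `C n`, so by
convexity `‖u‖_Φ ≤ 2⁻ⁿ (1 + C n * r)` for all `n`, where `r` is the integral. The infimum over `n`
of these affine functions of `r` vanishes continuously at `0` (`exists_luxemburgNorm_le`).

(ii) ⇒ (iii): a `𝒦ℒ` function decreases in time, which gives UBEBS. Zero input gives `‖T(t)x‖ ≤
b(‖x‖, t)`, hence `‖T(τ)‖ < 1` for some `τ`, and the semigroup law yields exponential decay.

(iii) ⇒ (i): under `Δ₂` one has `E_Φ = L_Φ` (`MemOrliczL.memOrliczE`), so UBEBS puts the response to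
every `L_Φ` input in `X`. A closed graph argument turns this membership into a bound on the unit
ball for a fixed horizon (`exists_uniform_bound_response`); it runs over `ℓ¹`, through absolutely
convergent series of inputs, and so needs no Banach space structure on `L_Φ`. Stability makes the
bound independent of the horizon (`exists_uniform_bound_response_of_stable`), and homogeneity makes
it linear in `‖u‖_Φ`. -/

/-! ### Elementary properties of Young functions -/

/-- A Young function lies above its supporting lines, whose slopes are nonnegative, and positive
except at the origin. -/
theorem IsYoungFunction.exists_subgradient {Φ : ℝ → ℝ} (hΦ : IsYoungFunction Φ) :
    ∃ φ : ℝ → ℝ, (∀ s, 0 ≤ s → 0 ≤ φ s) ∧ (∀ s, 0 < s → 0 < φ s) ∧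
      ∀ a b, 0 ≤ a → 0 ≤ b → Φ a + φ a * (b - a) ≤ Φ b := by
  obtain ⟨φ, -, hmono, h0, hpos, -, hint⟩ := hΦ
  have hnn : ∀ s, 0 ≤ s → 0 ≤ φ s := fun s hs => by
    have := hmono self_mem_Ici hs hs
    rwa [h0] at this
  refine ⟨φ, hnn, hpos, fun a b ha hb => ?_⟩
  have hii : ∀ a b, 0 ≤ a → 0 ≤ b → IntervalIntegrable φ volume a b := fun a b ha hb =>
    (hmono.mono fun x hx => (le_min ha hb).trans hx.1).intervalIntegrable
  have hsub : Φ b - Φ a = ∫ s in a..b, φ s := by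
    rw [hint a ha, hint b hb]
    exact intervalIntegral.integral_interval_sub_left (hii 0 b le_rfl hb) (hii 0 a le_rfl ha)
  have hc : φ a * (b - a) = ∫ _ in a..b, φ a := by
    rw [intervalIntegral.integral_const, smul_eq_mul, mul_comm]
  suffices φ a * (b - a) ≤ Φ b - Φ a by linarith
  rw [hsub, hc]
  rcases le_total a b with hab | hba
  · exact intervalIntegral.integral_mono_on hab (by simp) (hii a b ha hb)
      fun x hx => hmono ha (ha.trans hx.1) hx.1
  · rw [intervalIntegral.integral_symm, intervalIntegral.integral_symm b a, neg_le_neg_iff]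
    exact intervalIntegral.integral_mono_on hba (hii b a hb ha) (by simp)
      fun x hx => hmono (hb.trans hx.1) ha hx.2

theorem IsYoungFunction.map_zero {Φ : ℝ → ℝ} (hΦ : IsYoungFunction Φ) : Φ 0 = 0 := by
  obtain ⟨φ, -, -, -, -, -, hint⟩ := hΦ
  simp [hint 0 le_rfl]

theorem IsYoungFunction.strictMonoOn {Φ : ℝ → ℝ} (hΦ : IsYoungFunction Φ) :
    StrictMonoOn Φ (Ici 0) := by
  obtain ⟨φ, hnn, hpos, hsub⟩ := hΦ.exists_subgradient
  intro a (ha : 0 ≤ a) b _ hab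
  have hm : 0 < (a + b) / 2 := by linarith
  have h1 := hsub a ((a + b) / 2) ha hm.le
  have h2 := hsub ((a + b) / 2) b hm.le (by linarith)
  have h3 := mul_nonneg (hnn a ha) (by linarith : 0 ≤ (a + b) / 2 - a)
  have h4 := mul_pos (hpos _ hm) (by linarith : 0 < b - (a + b) / 2)
  linarith

theorem IsYoungFunction.monotoneOn {Φ : ℝ → ℝ} (hΦ : IsYoungFunction Φ) :
    MonotoneOn Φ (Ici 0) :=
  hΦ.strictMonoOn.monotoneOn

theorem IsYoungFunction.mono {Φ : ℝ → ℝ} (hΦ : IsYoungFunction Φ) {a b : ℝ} (ha : 0 ≤ a)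
    (hab : a ≤ b) : Φ a ≤ Φ b :=
  hΦ.monotoneOn ha (ha.trans hab) hab

theorem IsYoungFunction.nonneg {Φ : ℝ → ℝ} (hΦ : IsYoungFunction Φ) {a : ℝ} (ha : 0 ≤ a) :
    0 ≤ Φ a := by
  simpa [hΦ.map_zero] using hΦ.mono le_rfl ha

theorem IsYoungFunction.pos {Φ : ℝ → ℝ} (hΦ : IsYoungFunction Φ) {a : ℝ} (ha : 0 < a) :
    0 < Φ a := by
  simpa [hΦ.map_zero] using hΦ.strictMonoOn self_mem_Ici ha.le ha

/-- Average the supporting line at `c * a`, evaluated at `a` and at `0`, with weights `c` and `1 -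
c`: the slope terms cancel. -/
theorem IsYoungFunction.map_mul_le {Φ : ℝ → ℝ} (hΦ : IsYoungFunction Φ) {c a : ℝ} (hc : 0 ≤ c)
    (hc1 : c ≤ 1) (ha : 0 ≤ a) : Φ (c * a) ≤ c * Φ a := by
  obtain ⟨φ, -, -, hsub⟩ := hΦ.exists_subgradient
  have hca := mul_nonneg hc ha
  have h1 := mul_le_mul_of_nonneg_left (hsub (c * a) a hca ha) hc
  have h2 := mul_le_mul_of_nonneg_left (hsub (c * a) 0 hca le_rfl) (sub_nonneg.2 hc1)
  rw [hΦ.map_zero] at h2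
  nlinarith

/-- A version of `Φ` that is continuous on the whole line. -/
theorem IsYoungFunction.continuous_max {Φ : ℝ → ℝ} (hΦ : IsYoungFunction Φ) :
    Continuous fun s => Φ (max s 0) := by
  obtain ⟨φ, -, hmono, -, -, -, hint⟩ := hΦ
  have hm : Monotone fun s => φ (max s 0) := fun a b hab =>
    hmono (mem_Ici.2 (le_max_right a 0)) (mem_Ici.2 (le_max_right b 0)) (max_le_max_right 0 hab)
  have hc : Continuous fun t => ∫ s in (0 : ℝ)..t, φ (max s 0) :=
    intervalIntegral.continuous_primitive (fun a b => hm.intervalIntegrable) 0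
  refine (hc.comp (continuous_id.max continuous_const : Continuous fun s : ℝ => max s 0)).congr
    fun t => ?_
  rw [Function.comp_apply, hint _ (le_max_right t 0)]
  refine intervalIntegral.integral_congr fun s hs => ?_
  rw [uIcc_of_le (le_max_right _ _)] at hs
  simp [max_eq_left hs.1]

theorem IsYoungFunction.continuous_nnreal {Φ : ℝ → ℝ} (hΦ : IsYoungFunction Φ) :
    Continuous fun s : ℝ≥0 => Φ s :=
  (hΦ.continuous_max.comp NNReal.continuous_coe).congr fun s => by simp

theorem IsYoungFunction.isClassK {Φ : ℝ → ℝ} (hΦ : IsYoungFunction Φ) :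
    IsClassK fun s => (Φ s).toNNReal := by
  refine ⟨by simp [hΦ.map_zero], continuous_real_toNNReal.comp hΦ.continuous_nnreal,
    fun a b hab => ?_⟩
  refine (Real.toNNReal_lt_toNNReal_iff_of_nonneg (hΦ.nonneg a.2)).2 ?_
  exact hΦ.strictMonoOn a.2 b.2 hab

/-- Jensen's inequality for series with weights of total mass at most one. -/
theorem IsYoungFunction.map_tsum_le {Φ : ℝ → ℝ} (hΦ : IsYoungFunction Φ) {w r : ℕ → ℝ}
    {W : ℝ} (hw : ∀ n, 0 ≤ w n) (hW : HasSum w W) (hW1 : W ≤ 1) (hr : ∀ n, 0 ≤ r n)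
    (hwr : Summable fun n => w n * r n) :
    ENNReal.ofReal (Φ (∑' n, w n * r n)) ≤ ∑' n, ENNReal.ofReal (w n * Φ (r n)) := by
  obtain ⟨φ, -, -, hsub⟩ := hΦ.exists_subgradient
  by_cases hs : Summable fun n => w n * Φ (r n)
  · rw [← ENNReal.ofReal_tsum_of_nonneg (fun n => mul_nonneg (hw n) (hΦ.nonneg (hr n))) hs]
    refine ENNReal.ofReal_le_ofReal ?_
    set m := ∑' n, w n * r n with hm
    have hm0 : 0 ≤ m := tsum_nonneg fun n => mul_nonneg (hw n) (hr n)
    have h1 : HasSum (fun n => w n * (Φ m - φ m * m) + φ m * (w n * r n))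
        (W * (Φ m - φ m * m) + φ m * m) :=
      (hW.mul_right _).add (hwr.hasSum.mul_left _)
    have h2 := hasSum_le (fun n => ?_) h1 hs.hasSum
    -- The supporting line at `m` has intercept `Φ m - φ m * m ≤ 0`, so giving it the weight `W ≤ 1`
    -- instead of `1` only raises the left side.
    · have h3 := hsub m 0 hm0 le_rfl
      rw [hΦ.map_zero] at h3
      nlinarith
    · have := mul_le_mul_of_nonneg_left (hsub m (r n) hm0 (hr n)) (hw n)
      linarith
  · have : ∑' n, ENNReal.ofReal (w n * Φ (r n)) = ∞ := by
      by_contra hne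
      refine hs ?_
      have := ENNReal.summable_toReal hne
      simpa [ENNReal.toReal_ofReal, mul_nonneg (hw _) (hΦ.nonneg (hr _))] using this
    rw [this]
    exact le_top

/-- The gauge `Φ(s) + Φ(√s)`, which dominates all dilations of `Φ` when `Φ` is doubling at
infinity. -/
noncomputable def youngGauge (Φ : ℝ → ℝ) (s : ℝ≥0) : ℝ≥0 :=
  (Φ s).toNNReal + (Φ (NNReal.sqrt s)).toNNReal

theorem IsYoungFunction.isClassK_youngGauge {Φ : ℝ → ℝ} (hΦ : IsYoungFunction Φ) :
    IsClassK (youngGauge Φ) := by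
  obtain ⟨h0, hc, hm⟩ := hΦ.isClassK
  refine ⟨by simp [youngGauge, hΦ.map_zero], hc.add (hc.comp NNReal.continuous_sqrt), ?_⟩
  exact hm.add (hm.comp NNReal.sqrt.strictMono)

/-- `Δ₂` controls only large arguments. Near `0` the term `Φ(√s)` takes over, since `2ⁿ s ≤ √s` once
`s ≤ 4⁻ⁿ`; between the two ranges monotonicity suffices. -/
theorem IsYoungFunction.exists_dilation_le {Φ : ℝ → ℝ} (hΦ : IsYoungFunction Φ)
    (hΔ : SatisfiesDeltaTwo Φ) (n : ℕ) :
    ∃ C : ℝ≥0, ∀ s : ℝ≥0, Φ (2 ^ n * s) ≤ C * youngGauge Φ s := by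
  obtain ⟨k, u₀, hk, hu₀, hd⟩ := hΔ
  have hpow : ∀ m : ℕ, ∀ u, u₀ ≤ u → Φ (2 ^ m * u) ≤ k ^ m * Φ u := by
    intro m
    induction m with
    | zero => simp
    | succ m ih =>
      intro u hu
      have hu0 := hu₀.trans hu
      have h1 : u₀ ≤ 2 ^ m * u :=
        hu.trans (le_mul_of_one_le_left hu0 (one_le_pow₀ one_le_two))
      calc Φ (2 ^ (m + 1) * u) = Φ (2 * (2 ^ m * u)) := by ring_nf
        _ ≤ k * Φ (2 ^ m * u) := hd _ h1
        _ ≤ k * (k ^ m * Φ u) := mul_le_mul_of_nonneg_left (ih u hu) hk.le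
        _ = k ^ (m + 1) * Φ u := by ring
  set δ : ℝ := (2 ^ n)⁻¹ ^ 2 with hδ
  have hδ0 : 0 < δ := by positivity
  have hΦδ := hΦ.pos hδ0
  have hΦu := hΦ.nonneg (by positivity : 0 ≤ 2 ^ n * u₀)
  have hkn : 0 ≤ k ^ n := by positivity
  have hq : 0 ≤ Φ (2 ^ n * u₀) / Φ δ := by positivity
  -- One summand per range: `k ^ n` for `u₀ ≤ s`, the quotient for `δ ≤ s ≤ u₀`, and `1` for `s ≤
  -- δ`.
  refine ⟨(k ^ n + 1 + Φ (2 ^ n * u₀) / Φ δ).toNNReal, fun s => ?_⟩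
  have hs : (0 : ℝ) ≤ s := s.2
  have hΦs := hΦ.nonneg hs
  have hΦr := hΦ.nonneg (Real.sqrt_nonneg s)
  rw [Real.coe_toNNReal _ (by positivity), youngGauge, NNReal.coe_add, Real.coe_toNNReal _ hΦs,
    Real.coe_sqrt, Real.coe_toNNReal _ hΦr]
  rcases le_total u₀ s with h | h
  · have := hpow n s h
    nlinarith [mul_nonneg hkn hΦr, mul_nonneg hq hΦs, mul_nonneg hq hΦr]
  rcases le_total δ s with h' | h'
  · have h1 : Φ (2 ^ n * s) ≤ Φ (2 ^ n * u₀) := hΦ.mono (by positivity) (by gcongr)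
    have h2 : Φ (2 ^ n * u₀) ≤ Φ (2 ^ n * u₀) / Φ δ * Φ s := by
      rw [div_mul_eq_mul_div, le_div_iff₀ hΦδ]
      exact mul_le_mul_of_nonneg_left (hΦ.mono hδ0.le h') hΦu
    nlinarith [mul_nonneg hkn hΦr, mul_nonneg hkn hΦs, mul_nonneg hq hΦr]
  · have h1 : 2 ^ n * (s : ℝ) ≤ √s := by
      have h2 : √(s : ℝ) ≤ (2 ^ n)⁻¹ := Real.sqrt_le_iff.2 ⟨by positivity, h'⟩
      calc 2 ^ n * (s : ℝ) = 2 ^ n * √s * √s := by rw [mul_assoc, Real.mul_self_sqrt hs]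
        _ ≤ 2 ^ n * (2 ^ n)⁻¹ * √s := by gcongr
        _ = √s := by rw [mul_inv_cancel₀ (by positivity), one_mul]
    have h3 : Φ (2 ^ n * s) ≤ Φ √s := hΦ.mono (by positivity) h1
    nlinarith [mul_nonneg hkn hΦr, mul_nonneg hkn hΦs, mul_nonneg hq hΦr, mul_nonneg hq hΦs]

/-! ### A `𝒦_∞` majorant -/

/-- The infimum of the affine functions is monotone and subadditive and tends to `0` at `0`, hence
is continuous everywhere. Adding the identity makes it strictly increasing and unbounded. -/
theorem exists_isClassKInfty_of_affine_bounds (c C : ℕ → ℝ≥0) (hc : Tendsto c atTop (𝓝 0)) :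
    ∃ θ, IsClassKInfty θ ∧ ∀ r s : ℝ≥0, (∀ n, r ≤ c n + C n * s) → r ≤ θ s := by
  set f : ℝ≥0 → ℝ≥0 := fun s => ⨅ n, (c n + C n * s) with hf
  have hle : ∀ n s, f s ≤ c n + C n * s := fun n s => ciInf_le (OrderBot.bddBelow _) n
  have hmono : Monotone f := fun s t hst =>
    le_ciInf fun n => (hle n s).trans (by gcongr)
  have hsub : ∀ s h, f (s + h) ≤ f s + f h := by
    intro s h
    -- Of the two affine functions, the one with the smaller slope bounds `f (s + h)`.
    refine NNReal.le_iInf_add_iInf fun n m => ?_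
    rcases le_total (C n) (C m) with hnm | hnm
    · calc f (s + h) ≤ c n + C n * (s + h) := hle n _
        _ = c n + C n * s + C n * h := by ring
        _ ≤ c n + C n * s + (c m + C m * h) := by
          gcongr
          exact (mul_le_mul_left hnm h).trans le_add_self
    · calc f (s + h) ≤ c m + C m * (s + h) := hle m _
        _ = C m * s + (c m + C m * h) := by ring
        _ ≤ c n + C n * s + (c m + C m * h) := by
          gcongr
          exact (mul_le_mul_left hnm s).trans le_add_self
  have hlim : Tendsto f (𝓝 0) (𝓝 0) := by
    refine tendsto_order.2 ⟨fun a ha => absurd ha not_lt_zero, fun a ha => ?_⟩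
    obtain ⟨n, hn⟩ := (hc.eventually_lt_const ha).exists
    have hcont : Tendsto (fun s => c n + C n * s) (𝓝 0) (𝓝 (c n + C n * 0)) :=
      (continuous_const.add (continuous_const.mul continuous_id)).tendsto 0
    rw [mul_zero, add_zero] at hcont
    filter_upwards [hcont.eventually_lt_const hn] with s hs using (hle n s).trans_lt hs
  have h0 : f 0 = 0 := le_antisymm
    (ge_of_tendsto' hc fun n => by simpa using hle n 0) bot_le
  have hcont : Continuous f := by
    rw [continuous_iff_continuousAt]
    intro s
    have hd : Tendsto (fun t => f (nndist t s)) (𝓝 s) (𝓝 0) := by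
      refine hlim.comp ?_
      have : Continuous fun t => nndist t s := by fun_prop
      simpa using this.tendsto s
    refine tendsto_iff_dist_tendsto_zero.2 (squeeze_zero (fun _ => dist_nonneg) (fun t => ?_)
      (NNReal.tendsto_coe.2 hd))
    -- Subadditivity makes `f` its own modulus of continuity.
    have key : ∀ a b, f a ≤ f b + f (nndist a b) := fun a b => by
      refine (hmono ?_).trans (hsub _ _)
      rw [← NNReal.coe_le_coe, NNReal.coe_add, coe_nndist, NNReal.dist_eq]
      linarith [le_abs_self ((a : ℝ) - b)]
    have h1 := key t s
    have h2 := key s t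
    rw [nndist_comm] at h2
    rw [NNReal.dist_eq, abs_le]
    have h1' : (f t : ℝ) ≤ f s + f (nndist t s) := by exact_mod_cast h1
    have h2' : (f s : ℝ) ≤ f t + f (nndist t s) := by exact_mod_cast h2
    constructor <;> linarith
  refine ⟨fun s => s + f s, ⟨⟨by simp [h0], continuous_id.add hcont,
    strictMono_id.add_monotone hmono⟩, tendsto_atTop_mono (fun s => le_self_add) tendsto_id⟩,
    fun r s h => (le_ciInf h).trans le_add_self⟩

/-! ### Modulars and Luxemburg norms -/

section Orlicz

variable {U : Type*} [NormedAddCommGroup U] {Φ : ℝ → ℝ} {t : ℝ≥0} {u : ℝ → U}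

theorem luxemburgNorm_le_of_modular_le_one {k : ℝ} (hk : 0 < k) (h : orliczModular Φ t k u ≤ 1) :
    (luxemburgNorm Φ t u : ℝ) ≤ k := by
  rw [luxemburgNorm, Real.coe_toNNReal _ (Real.sInf_nonneg fun x hx => hx.1.le)]
  exact csInf_le ⟨0, fun x hx => hx.1.le⟩ ⟨hk, h⟩

theorem IsYoungFunction.modular_mul_le (hΦ : IsYoungFunction Φ) {k : ℝ} (hk : 0 < k) {c : ℝ≥0}
    (hc : 1 ≤ c) : orliczModular Φ t (k * c) u ≤ (c : ℝ≥0∞)⁻¹ * orliczModular Φ t k u := by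
  have hc0 : (0 : ℝ) < c := by exact_mod_cast zero_lt_one.trans_le hc
  have hcne : c ≠ 0 := fun h => by simp [h] at hc0
  rw [orliczModular, orliczModular, ← ENNReal.coe_inv hcne,
    ← lintegral_const_mul' _ _ ENNReal.coe_ne_top]
  refine lintegral_mono fun s => ?_
  have h1 : (k * c)⁻¹ * ‖u s‖ = (c : ℝ)⁻¹ * (k⁻¹ * ‖u s‖) := by
    rw [mul_inv]
    ring
  rw [h1, ← ENNReal.ofReal_coe_nnreal, ← ENNReal.ofReal_mul (by positivity), NNReal.coe_inv]
  exact ENNReal.ofReal_le_ofReal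
    (hΦ.map_mul_le (by positivity) (inv_le_one_of_one_le₀ (by exact_mod_cast hc)) (by positivity))

theorem IsYoungFunction.modular_mul_one_add_le_one (hΦ : IsYoungFunction Φ) {k : ℝ} (hk : 0 < k)
    {I : ℝ≥0} (h : orliczModular Φ t k u ≤ I) : orliczModular Φ t (k * (1 + I : ℝ≥0)) u ≤ 1 := by
  refine (hΦ.modular_mul_le hk le_self_add).trans ?_
  rw [mul_comm, ← div_eq_mul_inv]
  refine ENNReal.div_le_of_le_mul ?_
  rw [one_mul]
  refine h.trans ?_
  exact_mod_cast le_add_self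

theorem IsYoungFunction.luxemburgNorm_le (hΦ : IsYoungFunction Φ) {k : ℝ} (hk : 0 < k) {I : ℝ≥0}
    (h : orliczModular Φ t k u ≤ I) : (luxemburgNorm Φ t u : ℝ) ≤ k * (1 + I : ℝ≥0) :=
  luxemburgNorm_le_of_modular_le_one (mul_pos hk (by positivity))
    (hΦ.modular_mul_one_add_le_one hk h)

theorem IsYoungFunction.le_mul_luxemburgNorm (hΦ : IsYoungFunction Φ) (hu : MemOrliczL Φ t u)
    {x C : ℝ} (hC : 0 < C)
    (h : ∀ k, 0 < k → orliczModular Φ t k u ≤ 1 → x ≤ C * k) : x ≤ C * luxemburgNorm Φ t u := by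
  rw [luxemburgNorm, Real.coe_toNNReal _ (Real.sInf_nonneg fun x hx => hx.1.le), mul_comm,
    ← div_le_iff₀ hC]
  refine le_csInf ?_ fun k hk => by
    rw [div_le_iff₀ hC, mul_comm]
    exact h k hk.1 hk.2
  -- The set of admissible `k` must be nonempty, since the infimum of the empty set is `0` by
  -- convention.
  obtain ⟨-, k, hk, hm⟩ := hu
  exact ⟨_, mul_pos hk (by positivity),
    hΦ.modular_mul_one_add_le_one (I := (orliczModular Φ t k u).toNNReal) hk
      (ENNReal.coe_toNNReal hm.ne).ge⟩

theorem IsYoungFunction.exists_luxemburgNorm_le (hΦ : IsYoungFunction Φ)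
    (hΔ : SatisfiesDeltaTwo Φ) :
    ∃ θ, IsClassKInfty θ ∧ ∀ (t : ℝ≥0) (u : ℝ → U),
      ∫⁻ s in Ioo (0 : ℝ) t, (youngGauge Φ ‖u s‖₊ : ℝ≥0∞) < ∞ →
        luxemburgNorm Φ t u ≤
          θ (∫⁻ s in Ioo (0 : ℝ) t, (youngGauge Φ ‖u s‖₊ : ℝ≥0∞)).toNNReal := by
  choose C hC using hΦ.exists_dilation_le hΔ
  obtain ⟨θ, hθ, hle⟩ := exists_isClassKInfty_of_affine_bounds (fun n => (2 ^ n)⁻¹)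
    (fun n => (2 ^ n)⁻¹ * C n) (by
      have h2 : (2⁻¹ : ℝ≥0) < 1 := by
        rw [← NNReal.coe_lt_coe]
        norm_num
      simpa [inv_pow] using tendsto_pow_atTop_nhds_zero_of_lt_one bot_le h2)
  refine ⟨θ, hθ, fun t u hfin => hle _ _ fun n => ?_⟩
  set r := (∫⁻ s in Ioo (0 : ℝ) t, (youngGauge Φ ‖u s‖₊ : ℝ≥0∞)).toNNReal with hr
  have h1 : orliczModular Φ t ((2 ^ n)⁻¹) u ≤ (C n * r : ℝ≥0) := by
    rw [ENNReal.coe_mul, hr, ENNReal.coe_toNNReal hfin.ne, orliczModular,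
      ← lintegral_const_mul' _ _ ENNReal.coe_ne_top]
    refine lintegral_mono fun s => ?_
    rw [← ENNReal.coe_mul, inv_inv, ← ENNReal.ofReal_coe_nnreal]
    exact ENNReal.ofReal_le_ofReal (by exact_mod_cast hC n ‖u s‖₊)
  have h2 := hΦ.luxemburgNorm_le (by positivity) h1
  rw [← NNReal.coe_le_coe]
  refine h2.trans_eq ?_
  push_cast
  ring

theorem IsYoungFunction.aemeasurable_modular (hΦ : IsYoungFunction Φ) {ν : Measure ℝ}
    (hu : AEStronglyMeasurable u ν) {k : ℝ} (hk : 0 < k) :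
    AEMeasurable (fun s => ENNReal.ofReal (Φ (k⁻¹ * ‖u s‖))) ν := by
  have h := hΦ.continuous_max.measurable.comp_aemeasurable
    ((hu.norm.aemeasurable).const_mul k⁻¹)
  refine (h.congr (Eventually.of_forall fun s => ?_)).ennreal_ofReal
  simp only [Function.comp_apply]
  rw [max_eq_left (by positivity)]

/-- Since `Φ(√s) ≤ Φ 1 + Φ s`, the gauge exceeds `2 * Φ s` by at most a constant, which is
integrable on a bounded interval. -/
theorem IsYoungFunction.modular_dilation_lt_top (hΦ : IsYoungFunction Φ)
    (hΔ : SatisfiesDeltaTwo Φ) {k : ℝ} (hk : 0 < k) (h : orliczModular Φ t k u < ∞) (n : ℕ) :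
    orliczModular Φ t (k * (2 ^ n)⁻¹) u < ∞ := by
  obtain ⟨C, hC⟩ := hΦ.exists_dilation_le hΔ n
  have hΦ1 := hΦ.nonneg zero_le_one
  have hle : ∀ s : ℝ≥0, Φ (2 ^ n * s) ≤ C * Φ 1 + (2 * C) * Φ s := by
    intro s
    have hs : (0 : ℝ) ≤ s := s.2
    have h1 : Φ √(s : ℝ) ≤ Φ 1 + Φ s := by
      rcases le_total (s : ℝ) 1 with h | h
      · linarith [hΦ.mono (Real.sqrt_nonneg _) (Real.sqrt_le_one.2 h), hΦ.nonneg hs]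
      · have h2 : √(s : ℝ) ≤ s := Real.sqrt_le_iff.2 ⟨hs, by nlinarith⟩
        linarith [hΦ.mono (Real.sqrt_nonneg _) h2]
    refine (hC s).trans ?_
    rw [youngGauge, NNReal.coe_add, Real.coe_sqrt, Real.coe_toNNReal _ (hΦ.nonneg hs),
      Real.coe_toNNReal _ (hΦ.nonneg (Real.sqrt_nonneg _))]
    nlinarith [C.2]
  have hbound : orliczModular Φ t (k * (2 ^ n)⁻¹) u ≤
      ∫⁻ s in Ioo (0 : ℝ) t, (ENNReal.ofReal (C * Φ 1) +
        ENNReal.ofReal (2 * C) * ENNReal.ofReal (Φ (k⁻¹ * ‖u s‖))) := by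
    refine lintegral_mono fun s => ?_
    have hs : 0 ≤ k⁻¹ * ‖u s‖ := by positivity
    rw [← ENNReal.ofReal_mul (by positivity),
      ← ENNReal.ofReal_add (by positivity) (mul_nonneg (by positivity) (hΦ.nonneg hs))]
    refine ENNReal.ofReal_le_ofReal ?_
    have : Φ (2 ^ n * (k⁻¹ * ‖u s‖)) ≤ C * Φ 1 + 2 * C * Φ (k⁻¹ * ‖u s‖) := hle ⟨_, hs⟩
    rwa [mul_inv, inv_inv, mul_comm k⁻¹, mul_assoc]
  refine hbound.trans_lt ?_
  rw [lintegral_add_left measurable_const, lintegral_const_mul' _ _ ENNReal.ofReal_ne_top,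
    lintegral_const]
  refine ENNReal.add_lt_top.2 ⟨ENNReal.mul_lt_top ENNReal.ofReal_lt_top ?_,
    ENNReal.mul_lt_top ENNReal.ofReal_lt_top h⟩
  simp

/-- Under the `Δ₂`-condition the bounded functions are dense in the Orlicz space. -/
theorem MemOrliczL.memOrliczE (hΦ : IsYoungFunction Φ) (hΔ : SatisfiesDeltaTwo Φ)
    (hu : MemOrliczL Φ t u) : MemOrliczE Φ t u := by
  refine ⟨hu, fun ε hε => ?_⟩
  obtain ⟨hm, k₀, hk₀, hfin⟩ := hu
  obtain ⟨N, hN⟩ : ∃ N : ℕ, k₀ * (2 ^ N)⁻¹ < (ε : ℝ) := by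
    obtain ⟨N, hN⟩ := exists_pow_lt_of_lt_one (div_pos (NNReal.coe_pos.2 hε) hk₀)
      (by norm_num : (2⁻¹ : ℝ) < 1)
    refine ⟨N, ?_⟩
    rwa [inv_pow, lt_div_iff₀ hk₀, mul_comm] at hN
  set k := k₀ * (2 ^ N)⁻¹ with hk
  have hk0 : 0 < k := by positivity
  set v : ℕ → ℝ → U := fun n => {s | ‖u s‖ ≤ n}.indicator u with hv
  have hvm : ∀ n, AEStronglyMeasurable (v n) (volume.restrict (Ioo (0 : ℝ) t)) := fun n =>
    hm.indicator₀ (nullMeasurableSet_le hm.norm.aemeasurable aemeasurable_const)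
  -- The truncations `v n` converge at the fixed scale `k < ε`; the dominating function is
  -- integrable at that scale by `Δ₂`.
  have hlim : Tendsto (fun n => orliczModular Φ t k (u - v n)) atTop
      (𝓝 (∫⁻ _ in Ioo (0 : ℝ) t, 0)) := by
    refine tendsto_lintegral_of_dominated_convergence'
      (fun s => ENNReal.ofReal (Φ (k⁻¹ * ‖u s‖)))
      (fun n => hΦ.aemeasurable_modular (hm.sub (hvm n)) hk0)
      (fun n => Eventually.of_forall fun s => ?_)
      (hΦ.modular_dilation_lt_top hΔ hk₀ hfin N).ne
      (Eventually.of_forall fun s => ?_)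
    · refine ENNReal.ofReal_le_ofReal (hΦ.mono (by positivity) ?_)
      gcongr
      by_cases h : s ∈ {s | ‖u s‖ ≤ n}
      · simp [hv, indicator_of_mem h]
      · simp [hv, indicator_of_notMem h]
    · refine tendsto_const_nhds.congr' ?_
      filter_upwards [eventually_ge_atTop ⌈‖u s‖⌉₊] with n hn
      have h : s ∈ {s | ‖u s‖ ≤ n} := Nat.ceil_le.1 hn
      simp [hv, indicator_of_mem h, hΦ.map_zero]
  rw [lintegral_zero] at hlim
  obtain ⟨n, hn⟩ := (hlim.eventually_le_const zero_lt_one).exists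
  refine ⟨v n, memLp_top_of_bound (hvm n) n (Eventually.of_forall fun s => ?_), ?_⟩
  · by_cases h : s ∈ {s | ‖u s‖ ≤ n}
    · simpa [hv, indicator_of_mem h] using h
    · simp [hv, indicator_of_notMem h]
  · rw [← NNReal.coe_lt_coe]
    exact (luxemburgNorm_le_of_modular_le_one hk0 hn).trans_lt hN

/-- The supporting line at `1` gives `x ≤ 1 + Φ x / φ 1`; integration over `(0, t)` bounds the
modular unit ball in `L¹`. -/
theorem IsYoungFunction.exists_lintegral_enorm_le (hΦ : IsYoungFunction Φ) (t : ℝ≥0) :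
    ∃ K : ℝ≥0, ∀ u : ℝ → U, orliczModular Φ t 1 u ≤ 1 →
      ∫⁻ s in Ioo (0 : ℝ) t, ‖u s‖ₑ ≤ K := by
  obtain ⟨φ, -, hpos, hsub⟩ := hΦ.exists_subgradient
  have hφ := hpos 1 one_pos
  refine ⟨t + (φ 1)⁻¹.toNNReal, fun u hu => ?_⟩
  have hpt : ∀ s, ‖u s‖ₑ ≤ 1 + ENNReal.ofReal (φ 1)⁻¹ *
      ENNReal.ofReal (Φ ((1 : ℝ)⁻¹ * ‖u s‖)) := by
    intro s
    have h1 := hsub 1 ‖u s‖ zero_le_one (norm_nonneg _)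
    have h2 := hΦ.nonneg zero_le_one
    rw [← ENNReal.ofReal_mul (by positivity), ← ENNReal.ofReal_one,
      ← ENNReal.ofReal_add zero_le_one
        (mul_nonneg (by positivity) (hΦ.nonneg (by positivity))), ← ofReal_norm]
    refine ENNReal.ofReal_le_ofReal ?_
    rw [inv_one, one_mul, ← sub_le_iff_le_add', inv_mul_eq_div, le_div_iff₀ hφ]
    linarith
  refine (lintegral_mono hpt).trans ?_
  rw [lintegral_add_left measurable_const, lintegral_const_mul' _ _ ENNReal.ofReal_ne_top,
    lintegral_const, ENNReal.coe_add]
  refine add_le_add (by simp) ?_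
  calc _ ≤ ENNReal.ofReal (φ 1)⁻¹ * 1 := by gcongr; exact hu
    _ = _ := by simp [ENNReal.ofReal]

theorem IsYoungFunction.memOrliczE_zero (hΦ : IsYoungFunction Φ) (t : ℝ≥0) :
    MemOrliczE Φ t (0 : ℝ → U) ∧ luxemburgNorm Φ t (0 : ℝ → U) = 0 := by
  have hmod : ∀ k, orliczModular Φ t k (0 : ℝ → U) = 0 := fun k => by
    simp [orliczModular, hΦ.map_zero]
  have hl : luxemburgNorm Φ t (0 : ℝ → U) = 0 := by
    refine le_antisymm (le_of_forall_pos_le_add fun ε hε => ?_) bot_le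
    rw [zero_add, ← NNReal.coe_le_coe]
    exact luxemburgNorm_le_of_modular_le_one (NNReal.coe_pos.2 hε) (by simp [hmod])
  refine ⟨⟨⟨aestronglyMeasurable_const, 1, one_pos, by simp [hmod]⟩, fun ε hε => ⟨0, ?_, ?_⟩⟩, hl⟩
  · exact MemLp.zero
  · rwa [sub_zero, hl]

end Orlicz

/-! ### Absolutely convergent series of inputs -/

section Series

variable {𝕜 U : Type*} [RCLike 𝕜] [NormedAddCommGroup U] [NormedSpace 𝕜 U]
  {Φ : ℝ → ℝ} {t : ℝ≥0}

theorem orliczModular_one_smul {k : ℝ} (hk : 0 < k) (u : ℝ → U) :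
    orliczModular Φ t 1 ((k : 𝕜)⁻¹ • u) = orliczModular Φ t k u := by
  simp [orliczModular, norm_smul, abs_of_pos hk]

variable {a : ℕ → 𝕜} {u : ℕ → ℝ → U}

theorem IsYoungFunction.tsum_lintegral_enorm_lt_top (hΦ : IsYoungFunction Φ)
    (ha : Summable fun n => ‖a n‖) (hu1 : ∀ n, orliczModular Φ t 1 (u n) ≤ 1) :
    ∑' n, ∫⁻ s in Ioo (0 : ℝ) t, ‖a n • u n s‖ₑ < ∞ := by
  obtain ⟨K, hK⟩ := hΦ.exists_lintegral_enorm_le (U := U) t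
  calc ∑' n, ∫⁻ s in Ioo (0 : ℝ) t, ‖a n • u n s‖ₑ
      = ∑' n, ‖a n‖ₑ * ∫⁻ s in Ioo (0 : ℝ) t, ‖u n s‖ₑ := by
        refine tsum_congr fun n => ?_
        simp_rw [enorm_smul]
        exact lintegral_const_mul' _ _ enorm_ne_top
    _ ≤ ∑' n, ‖a n‖ₑ * K := ENNReal.tsum_le_tsum fun n => by gcongr; exact hK _ (hu1 n)
    _ = (∑' n, ‖a n‖ₑ) * K := ENNReal.tsum_mul_right
    _ < ∞ := ENNReal.mul_lt_top (by
      rw [lt_top_iff_ne_top]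
      simp_rw [← ofReal_norm]
      exact ha.tsum_ofReal_ne_top) ENNReal.coe_lt_top

theorem IsYoungFunction.ae_summable_norm_smul (hΦ : IsYoungFunction Φ)
    (ha : Summable fun n => ‖a n‖)
    (hu : ∀ n, AEStronglyMeasurable (u n) (volume.restrict (Ioo (0 : ℝ) t)))
    (hu1 : ∀ n, orliczModular Φ t 1 (u n) ≤ 1) :
    ∀ᵐ s ∂volume.restrict (Ioo (0 : ℝ) t), Summable fun n => ‖a n • u n s‖ := by
  have h := hΦ.tsum_lintegral_enorm_lt_top ha hu1
  have hm : ∀ n, AEMeasurable (fun s => ‖a n • u n s‖ₑ) (volume.restrict (Ioo (0 : ℝ) t)) :=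
    fun n => ((hu n).const_smul (a n)).enorm
  rw [← lintegral_tsum hm] at h
  filter_upwards [ae_lt_top' (AEMeasurable.tsum hm) h.ne] with s hs
  have := ENNReal.summable_toReal hs.ne
  simpa using this

/-- With `A = ∑ ‖a n‖`, the weights `‖a n‖ / (1 + A)` have mass at most one, so Jensen's inequality
bounds the modular at scale `1 + A` termwise. The scale is `1 + A` so as to be positive even when
all coefficients vanish. -/
theorem IsYoungFunction.memOrliczL_tsum [CompleteSpace U] (hΦ : IsYoungFunction Φ)
    (ha : Summable fun n => ‖a n‖)
    (hu : ∀ n, AEStronglyMeasurable (u n) (volume.restrict (Ioo (0 : ℝ) t)))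
    (hu1 : ∀ n, orliczModular Φ t 1 (u n) ≤ 1) :
    MemOrliczL Φ t fun s => ∑' n, a n • u n s := by
  have hs := hΦ.ae_summable_norm_smul ha hu hu1
  constructor
  · refine aestronglyMeasurable_of_tendsto_ae atTop
      (f := fun N s => ∑ n ∈ Finset.range N, a n • u n s) (fun N => ?_) ?_
    · exact Finset.aestronglyMeasurable_fun_sum _ fun n _ => (hu n).const_smul (a n)
    · filter_upwards [hs] with s hs using hs.of_norm.hasSum.tendsto_sum_nat
  set A := ∑' n, ‖a n‖ with hA
  have hA0 : 0 ≤ A := tsum_nonneg fun n => norm_nonneg _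
  have hA1 : 0 < 1 + A := by linarith
  have hw : HasSum (fun n => (1 + A)⁻¹ * ‖a n‖) ((1 + A)⁻¹ * A) := ha.hasSum.mul_left _
  have hw1 : (1 + A)⁻¹ * A ≤ 1 := by
    rw [inv_mul_le_iff₀ hA1]
    linarith
  refine ⟨1 + A, hA1, ?_⟩
  calc orliczModular Φ t (1 + A) (fun s => ∑' n, a n • u n s)
      ≤ ∫⁻ s in Ioo (0 : ℝ) t, ∑' n, ENNReal.ofReal ((1 + A)⁻¹ * ‖a n‖) *
          ENNReal.ofReal (Φ ((1 : ℝ)⁻¹ * ‖u n s‖)) := by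
        refine lintegral_mono_ae ?_
        filter_upwards [hs] with s hs
        have hs' : Summable fun n => (1 + A)⁻¹ * ‖a n‖ * ‖u n s‖ := by
          simp_rw [norm_smul] at hs
          simpa only [mul_assoc] using hs.mul_left (1 + A)⁻¹
        have hnn : ∀ n, 0 ≤ (1 + A)⁻¹ * ‖a n‖ := fun n => by positivity
        refine (ENNReal.ofReal_le_ofReal (hΦ.mono (by positivity) ?_)).trans
          ((hΦ.map_tsum_le hnn hw hw1 (fun n => norm_nonneg _) hs').trans_eq ?_)
        · simp_rw [mul_assoc, tsum_mul_left, ← norm_smul]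
          gcongr
          exact norm_tsum_le_tsum_norm hs
        · simp [ENNReal.ofReal_mul (hnn _)]
    _ = ∑' n, ENNReal.ofReal ((1 + A)⁻¹ * ‖a n‖) * orliczModular Φ t 1 (u n) := by
        rw [lintegral_tsum fun n => (hΦ.aemeasurable_modular (hu n) one_pos).const_mul _]
        exact tsum_congr fun n => lintegral_const_mul' _ _ ENNReal.ofReal_ne_top
    _ ≤ ∑' n, ENNReal.ofReal ((1 + A)⁻¹ * ‖a n‖) * 1 :=
        ENNReal.tsum_le_tsum fun n => by gcongr; exact hu1 n
    _ < ∞ := by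
        simp_rw [mul_one]
        exact hw.summable.tsum_ofReal_lt_top

end Series

/-! ### Shifted and delayed inputs -/

theorem measurePreserving_add_left_Ioo (c a b : ℝ) :
    MeasurePreserving (fun s => c + s) (volume.restrict (Ioo a b))
      (volume.restrict (Ioo (c + a) (c + b))) := by
  have h := (measurePreserving_add_left volume c).restrict_preimage
    (measurableSet_Ioo (a := c + a) (b := c + b))
  rwa [preimage_const_add_Ioo, add_sub_cancel_left, add_sub_cancel_left] at h

theorem lintegral_Ioo_add_left (c a b : ℝ) (f : ℝ → ℝ≥0∞) :
    ∫⁻ s in Ioo a b, f (c + s) = ∫⁻ s in Ioo (c + a) (c + b), f s :=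
  (measurePreserving_add_left_Ioo c a b).lintegral_comp_emb (measurableEmbedding_addLeft c) f

section Shift

variable {U : Type*} [NormedAddCommGroup U] {Φ : ℝ → ℝ} {u : ℝ → U}

theorem aestronglyMeasurable_shift {r t : ℝ≥0}
    (hu : AEStronglyMeasurable u (volume.restrict (Ioo (0 : ℝ) (r + t : ℝ≥0)))) :
    AEStronglyMeasurable (fun s => u (r + s)) (volume.restrict (Ioo (0 : ℝ) t)) := by
  refine AEStronglyMeasurable.comp_measurePreserving ?_ (measurePreserving_add_left_Ioo r 0 t)
  exact hu.mono_measure (Measure.restrict_mono_set _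
    (Ioo_subset_Ioo (by simp) (by simp)))

theorem orliczModular_shift_le (r t : ℝ≥0) (k : ℝ) :
    orliczModular Φ t k (fun s => u (r + s)) ≤ orliczModular Φ (r + t) k u := by
  rw [orliczModular, lintegral_Ioo_add_left r 0 t fun s => ENNReal.ofReal (Φ (k⁻¹ * ‖u s‖))]
  exact lintegral_mono_set (Ioo_subset_Ioo (by simp) (by simp))

theorem orliczModular_mono {r t : ℝ≥0} (h : r ≤ t) (k : ℝ) :
    orliczModular Φ r k u ≤ orliczModular Φ t k u :=
  lintegral_mono_set (Ioo_subset_Ioo_right (by exact_mod_cast h))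

/-- The input that rests until time `r` and then runs through `u`. -/
noncomputable def delayedInput (r : ℝ≥0) (u : ℝ → U) : ℝ → U :=
  (Ioi (r : ℝ)).indicator fun s => u (-r + s)

theorem delayedInput_add {r : ℝ≥0} {s : ℝ} (hs : 0 < s) : delayedInput r u (r + s) = u s := by
  rw [delayedInput, indicator_of_mem (by simpa using hs), neg_add_cancel_left]

theorem delayedInput_of_le {r : ℝ≥0} {s : ℝ} (hs : s ≤ r) : delayedInput r u s = 0 :=
  indicator_of_notMem (by simpa using hs) _

theorem Ioo_zero_inter_Ioi (r t : ℝ≥0) :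
    Ioi (r : ℝ) ∩ Ioo (0 : ℝ) (r + t : ℝ≥0) = Ioo (r + 0 : ℝ) (r + t : ℝ) := by
  ext s
  simp only [mem_inter_iff, mem_Ioi, mem_Ioo, NNReal.coe_add, add_zero]
  exact ⟨fun h => ⟨h.1, h.2.2⟩, fun h => ⟨h.1, r.2.trans_lt h.1, h.2⟩⟩

theorem aestronglyMeasurable_delayedInput {r t : ℝ≥0}
    (hu : AEStronglyMeasurable u (volume.restrict (Ioo (0 : ℝ) t))) :
    AEStronglyMeasurable (delayedInput r u)
      (volume.restrict (Ioo (0 : ℝ) (r + t : ℝ≥0))) := by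
  rw [delayedInput, aestronglyMeasurable_indicator_iff measurableSet_Ioi,
    Measure.restrict_restrict measurableSet_Ioi, Ioo_zero_inter_Ioi]
  refine AEStronglyMeasurable.comp_measurePreserving ?_
    (measurePreserving_add_left_Ioo (-r) (r + 0) (r + t))
  rwa [neg_add_cancel_left, neg_add_cancel_left]

theorem IsYoungFunction.modular_delayedInput (hΦ : IsYoungFunction Φ) (r t : ℝ≥0) (k : ℝ) :
    orliczModular Φ (r + t) k (delayedInput r u) = orliczModular Φ t k u := by
  have h1 : ∀ s, ENNReal.ofReal (Φ (k⁻¹ * ‖delayedInput r u s‖)) = (Ioi (r : ℝ)).indicator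
      (fun s => ENNReal.ofReal (Φ (k⁻¹ * ‖delayedInput r u s‖))) s := by
    intro s
    by_cases hs : s ∈ Ioi (r : ℝ)
    · rw [indicator_of_mem hs]
    · rw [indicator_of_notMem hs, delayedInput_of_le (not_lt.1 hs)]
      simp [hΦ.map_zero]
  rw [orliczModular, lintegral_congr h1, lintegral_indicator measurableSet_Ioi,
    Measure.restrict_restrict measurableSet_Ioi, Ioo_zero_inter_Ioi, ← lintegral_Ioo_add_left]
  refine setLIntegral_congr_fun measurableSet_Ioo fun s hs => ?_
  simp only [delayedInput_add hs.1]

theorem IsYoungFunction.exists_integrable_bound (hΦ : IsYoungFunction Φ) (t : ℝ≥0) :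
    ∃ K : ℝ, 0 ≤ K ∧ ∀ u : ℝ → U,
      AEStronglyMeasurable u (volume.restrict (Ioo (0 : ℝ) t)) → orliczModular Φ t 1 u ≤ 1 →
      IntegrableOn u (Ioo (0 : ℝ) t) ∧ ∫ s in Ioo (0 : ℝ) t, ‖u s‖ ≤ K := by
  obtain ⟨K, hK⟩ := hΦ.exists_lintegral_enorm_le (U := U) t
  refine ⟨K, K.2, fun u hu hu1 => ⟨⟨hu, (hK u hu1).trans_lt ENNReal.coe_lt_top⟩, ?_⟩⟩
  rw [integral_norm_eq_lintegral_enorm hu]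
  exact ENNReal.toReal_le_of_le_ofReal K.2 (by simpa using hK u hu1)

end Shift

/-! ### The extrapolated semigroup and the response to an input -/

namespace C0Semigroup

variable {𝕜 X : Type*} [RCLike 𝕜] [NormedAddCommGroup X] [NormedSpace 𝕜 X]

section Extrapolation

variable (T : C0Semigroup 𝕜 X) (β : T.generatorResolventSet)

theorem embed_injective : Function.Injective (T.embed β) := by
  rw [injective_iff_map_eq_zero]
  intro x hx
  have h := T.norm_embed β x
  rw [hx, norm_zero, eq_comm, norm_eq_zero] at h
  exact (injective_iff_map_eq_zero _).1 (T.resolventOp_injective β) x h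

theorem denseRange_embed : DenseRange (T.embed β) :=
  UniformSpace.Completion.denseRange_coe (α := T.PreExtrapolation β)

theorem extrapolatedOp_add (s t : ℝ≥0) (y : T.Extrapolation β) :
    T.extrapolatedOp β (s + t) y = T.extrapolatedOp β s (T.extrapolatedOp β t y) := by
  refine (T.denseRange_embed β).induction_on y
    (isClosed_eq (ContinuousLinearMap.continuous _)
      ((ContinuousLinearMap.continuous _).comp (ContinuousLinearMap.continuous _))) fun x => ?_
  simp [extrapolatedOp_embed, T.op_add]

theorem norm_extrapolatedOp_apply_le (t : ℝ≥0) (y : T.Extrapolation β) :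
    ‖T.extrapolatedOp β t y‖ ≤ ‖T.op t‖ * ‖y‖ := by
  refine (T.denseRange_embed β).induction_on y
    (isClosed_le (ContinuousLinearMap.continuous _).norm
      (continuous_const.mul continuous_norm)) fun x => ?_
  rw [extrapolatedOp_embed, norm_embed, norm_embed, resolventOp_comm]
  exact (T.op t).le_opNorm _

/-- The operators are uniformly Lipschitz with constant `M`, and orbits starting in the dense image
of `X` are continuous. Joint continuity is what makes the integrand of the response measurable. -/
theorem continuous_extrapolatedOp {M : ℝ≥0} (hM : ∀ t, ‖T.op t‖ ≤ M) :
    Continuous fun p : T.Extrapolation β × ℝ≥0 => T.extrapolatedOp β p.2 p.1 := by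
  refine continuous_prod_of_dense_continuous_lipschitzWith _ M (T.denseRange_embed β) ?_ ?_
  · rintro _ ⟨x, rfl⟩
    simp only [extrapolatedOp_embed]
    exact (T.embed β).continuous.comp (T.continuous_orbit x)
  · refine fun t => LipschitzWith.of_dist_le_mul fun y z => ?_
    rw [dist_eq_norm, dist_eq_norm, ← map_sub]
    exact (T.norm_extrapolatedOp_apply_le β t _).trans (by gcongr; exact hM t)

end Extrapolation

section Response

variable {U : Type*} [NormedAddCommGroup U] [NormedSpace 𝕜 U]
variable (T : C0Semigroup 𝕜 X) (β : T.generatorResolventSet) (B : U →L[𝕜] T.Extrapolation β)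

/-- The response `∫₀ᵗ T₋₁(t - s) B u(s) ds` to the input `u` from the zero state. -/
noncomputable def response (u : ℝ → U) (t : ℝ≥0) : T.Extrapolation β :=
  ∫ s in (0 : ℝ)..t, T.extrapolatedOp β ((t : ℝ) - s).toNNReal (B (u s))

theorem mildSolution_eq (x₀ : X) (u : ℝ → U) (t : ℝ≥0) :
    T.mildSolution β B x₀ u t = T.embed β (T.op t x₀) + T.response β B u t :=
  rfl

theorem response_zero (t : ℝ≥0) : T.response β B 0 t = 0 := by
  simp [response]

theorem response_eq_integral_Ioo (u : ℝ → U) (t : ℝ≥0) :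
    T.response β B u t =
      ∫ s in Ioo (0 : ℝ) t, T.extrapolatedOp β ((t : ℝ) - s).toNNReal (B (u s)) := by
  rw [response, intervalIntegral.integral_of_le t.coe_nonneg, integral_Ioc_eq_integral_Ioo]

variable {T}

theorem norm_integrand_le {M : ℝ≥0} (hM : ∀ t, ‖T.op t‖ ≤ M)
    (t : ℝ) (s : ℝ) (v : U) :
    ‖T.extrapolatedOp β (t - s).toNNReal (B v)‖ ≤ M * ‖B‖ * ‖v‖ := by
  rw [mul_assoc]
  exact (T.norm_extrapolatedOp_apply_le β _ _).trans
    (mul_le_mul (hM _) (B.le_opNorm v) (norm_nonneg _) M.2)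

theorem aestronglyMeasurable_integrand {M : ℝ≥0} (hM : ∀ t, ‖T.op t‖ ≤ M) {u : ℝ → U}
    {ν : Measure ℝ} (t : ℝ) (hu : AEStronglyMeasurable u ν) :
    AEStronglyMeasurable (fun s => T.extrapolatedOp β (t - s).toNNReal (B (u s))) ν := by
  have hc : Continuous fun s : ℝ => (t - s).toNNReal := by fun_prop
  have hBu : AEStronglyMeasurable (fun s => B (u s)) ν :=
    B.continuous.comp_aestronglyMeasurable hu
  have hp : AEStronglyMeasurable (fun s => (B (u s), (t - s).toNNReal)) ν :=
    hBu.prodMk hc.aestronglyMeasurable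
  exact Continuous.comp_aestronglyMeasurable
    (g := fun p : T.Extrapolation β × ℝ≥0 => T.extrapolatedOp β p.2 p.1)
    (f := fun s => (B (u s), (t - s).toNNReal)) (T.continuous_extrapolatedOp β hM) hp

theorem integrable_integrand {M : ℝ≥0} (hM : ∀ t, ‖T.op t‖ ≤ M)
    {u : ℝ → U} {S : Set ℝ} (t : ℝ) (hu : IntegrableOn u S) :
    IntegrableOn (fun s => T.extrapolatedOp β (t - s).toNNReal (B (u s))) S := by
  have h1 : Integrable (fun s => M * ‖B‖ * ‖u s‖) (volume.restrict S) := hu.norm.const_mul _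
  have h2 := aestronglyMeasurable_integrand β B hM t hu.aestronglyMeasurable
  exact Integrable.mono' h1 h2
    (Eventually.of_forall fun s => norm_integrand_le β B hM t s (u s))

theorem norm_response_le {M : ℝ≥0} (hM : ∀ t, ‖T.op t‖ ≤ M)
    {u : ℝ → U} {t : ℝ≥0} (hu : IntegrableOn u (Ioo (0 : ℝ) t)) :
    ‖T.response β B u t‖ ≤ M * ‖B‖ * ∫ s in Ioo (0 : ℝ) t, ‖u s‖ := by
  rw [response_eq_integral_Ioo, ← integral_const_mul]
  exact norm_integral_le_of_norm_le (hu.norm.const_mul _)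
    (Eventually.of_forall fun s => norm_integrand_le β B hM t s (u s))

theorem response_smul {M : ℝ≥0} (hM : ∀ t, ‖T.op t‖ ≤ M)
    {u : ℝ → U} {t : ℝ≥0} (c : 𝕜) (hu : IntegrableOn u (Ioo (0 : ℝ) t)) :
    T.response β B (c • u) t = c • T.response β B u t := by
  rw [response_eq_integral_Ioo, response_eq_integral_Ioo]
  have h := (c • ContinuousLinearMap.id 𝕜 (T.Extrapolation β)).integral_comp_comm
    (integrable_integrand β B hM t hu)
  simpa using h

/-- Split the integral at `r` and pull `T₋₁(t)` out of the first part: the state reached at time `r`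
evolves freely while the remaining input acts from rest. -/
theorem response_add {M : ℝ≥0} (hM : ∀ t, ‖T.op t‖ ≤ M)
    {u : ℝ → U} {r t : ℝ≥0}
    (hu : IntegrableOn u (Ioo (0 : ℝ) (r + t : ℝ≥0))) :
    T.response β B u (r + t) = T.extrapolatedOp β t (T.response β B u r) +
      T.response β B (fun s => u (r + s)) t := by
  have hint : ∀ a b : ℝ, 0 ≤ a → a ≤ b → b ≤ (r + t : ℝ≥0) → ∀ c : ℝ, IntervalIntegrable
      (fun s => T.extrapolatedOp β (c - s).toNNReal (B (u s))) volume a b := by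
    intro a b ha hab hb c
    rw [intervalIntegrable_iff_integrableOn_Ioo_of_le hab]
    exact integrable_integrand β B hM c (hu.mono_set (Ioo_subset_Ioo ha hb))
  have hrt : (r : ℝ) ≤ (r + t : ℝ≥0) := by simp
  rw [response, ← intervalIntegral.integral_add_adjacent_intervals
    (hint 0 r le_rfl r.2 hrt _) (hint r _ r.2 hrt le_rfl _)]
  congr 1
  · rw [response, ← (T.extrapolatedOp β t).intervalIntegral_comp_comm
      (hint 0 r le_rfl r.2 hrt _)]
    refine intervalIntegral.integral_congr fun s hs => ?_
    rw [uIcc_of_le r.coe_nonneg] at hs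
    rw [← extrapolatedOp_add]
    congr 2
    rw [NNReal.coe_add, add_comm (r : ℝ), add_sub_assoc,
      Real.toNNReal_add t.coe_nonneg (sub_nonneg.2 hs.2), Real.toNNReal_coe]
  · have h := intervalIntegral.integral_comp_add_left (a := 0) (b := t)
      (fun s => T.extrapolatedOp β (((r + t : ℝ≥0) : ℝ) - s).toNNReal (B (u s))) (r : ℝ)
    rw [add_zero, ← NNReal.coe_add] at h
    rw [← h, response]
    refine intervalIntegral.integral_congr fun s _ => ?_
    simp only [NNReal.coe_add, add_sub_add_left_eq_sub]

theorem response_delayedInput {M : ℝ≥0} (hM : ∀ t, ‖T.op t‖ ≤ M)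
    {u : ℝ → U} {r t : ℝ≥0}
    (hu : IntegrableOn (delayedInput r u) (Ioo (0 : ℝ) (r + t : ℝ≥0))) :
    T.response β B (delayedInput r u) (r + t) = T.response β B u t := by
  rw [response_add β B hM hu]
  have h0 : T.response β B (delayedInput r u) r = 0 := by
    rw [response_eq_integral_Ioo]
    refine setIntegral_eq_zero_of_forall_eq_zero fun s hs => ?_
    rw [delayedInput_of_le hs.2.le, map_zero, map_zero]
  rw [h0, map_zero, zero_add, response_eq_integral_Ioo, response_eq_integral_Ioo]
  refine setIntegral_congr_fun measurableSet_Ioo fun s hs => ?_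
  simp only [delayedInput_add hs.1]

/-- Sum and integral may be exchanged because the `L¹` norms of the terms are at most `M * ‖B‖ * K *
‖a n‖`, which is summable. -/
theorem response_tsum [CompleteSpace U] {M : ℝ≥0} (hM : ∀ t, ‖T.op t‖ ≤ M)
    {Φ : ℝ → ℝ} (hΦ : IsYoungFunction Φ) {t : ℝ≥0}
    {a : ℕ → 𝕜} {u : ℕ → ℝ → U} (ha : Summable fun n => ‖a n‖)
    (hu : ∀ n, AEStronglyMeasurable (u n) (volume.restrict (Ioo (0 : ℝ) t)))
    (hu1 : ∀ n, orliczModular Φ t 1 (u n) ≤ 1) :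
    T.response β B (fun s => ∑' n, a n • u n s) t = ∑' n, a n • T.response β B (u n) t := by
  obtain ⟨K, hK0, hK⟩ := hΦ.exists_integrable_bound (U := U) t
  have hi := fun n => (hK (u n) (hu n) (hu1 n)).1
  have his : ∀ n, IntegrableOn (a n • u n) (Ioo (0 : ℝ) t) := fun n => (hi n).smul (a n)
  have hF := fun n => integrable_integrand β B hM t (his n)
  have hs : Summable fun n => ∫ s in Ioo (0 : ℝ) t,
      ‖T.extrapolatedOp β ((t : ℝ) - s).toNNReal (B ((a n • u n) s))‖ := by
    refine Summable.of_nonneg_of_le (fun n => integral_nonneg fun s => norm_nonneg _) (fun n => ?_)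
      (ha.mul_right (M * ‖B‖ * K))
    calc _ ≤ ∫ s in Ioo (0 : ℝ) t, M * ‖B‖ * ‖(a n • u n) s‖ :=
          integral_mono (hF n).norm ((his n).norm.const_mul _)
            fun s => norm_integrand_le β B hM t s _
      _ = ‖a n‖ * (M * ‖B‖ * ∫ s in Ioo (0 : ℝ) t, ‖u n s‖) := by
          simp_rw [Pi.smul_apply, norm_smul, integral_const_mul]
          ring
      _ ≤ _ := by
          have := (hK (u n) (hu n) (hu1 n)).2
          gcongr
  have h := hasSum_integral_of_summable_integral_norm hF hs
  have h1 : ∀ n, ∫ s in Ioo (0 : ℝ) t,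
      T.extrapolatedOp β ((t : ℝ) - s).toNNReal (B ((a n • u n) s)) =
        a n • T.response β B (u n) t := fun n => by
    rw [← response_smul β B hM _ (hi n), response_eq_integral_Ioo]
  simp_rw [h1] at h
  rw [h.tsum_eq, response_eq_integral_Ioo]
  refine integral_congr_ae ?_
  filter_upwards [hΦ.ae_summable_norm_smul ha hu hu1] with s hs
  rw [B.map_tsum hs.of_norm, ContinuousLinearMap.map_tsum _ (B.summable hs.of_norm)]
  rfl

end Response

end C0Semigroup

/-! ### A closed graph argument over `ℓ¹` -/

/-- If all absolutely convergent combinations of a bounded sequence in `Z` lie in the range of an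
injective bounded operator `J`, then the preimages of the sequence are bounded. -/
theorem exists_bound_of_tsum_mem_range {𝕜 X Z : Type*} [RCLike 𝕜]
    [NormedAddCommGroup X] [NormedSpace 𝕜 X] [CompleteSpace X]
    [NormedAddCommGroup Z] [NormedSpace 𝕜 Z] [CompleteSpace Z]
    (J : X →L[𝕜] Z) (hJ : Function.Injective J) {y : ℕ → Z} {D : ℝ} (hD : ∀ n, ‖y n‖ ≤ D)
    (h : ∀ a : ℕ → 𝕜, (Summable fun n => ‖a n‖) → ∃ x, J x = ∑' n, a n • y n) :
    ∃ C : ℝ, ∀ n x, J x = y n → ‖x‖ ≤ C := by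
  have hsum : ∀ a : lp (fun _ : ℕ => 𝕜) 1, Summable fun n => ‖a n‖ := fun a => by
    simpa using (memℓp_gen_iff (by simp)).1 (lp.memℓp a)
  have hle : ∀ (a : lp (fun _ : ℕ => 𝕜) 1) n, ‖a n • y n‖ ≤ ‖a n‖ * D := fun a n => by
    rw [norm_smul]
    gcongr
    exact hD n
  have hsy : ∀ a : lp (fun _ : ℕ => 𝕜) 1, Summable fun n => a n • y n := fun a =>
    Summable.of_norm_bounded ((hsum a).mul_right D) (hle a)
  have hnorm : ∀ a : lp (fun _ : ℕ => 𝕜) 1, ‖a‖ = ∑' n, ‖a n‖ := fun a => by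
    simpa using lp.norm_eq_tsum_rpow (p := 1) (by simp) a
  let V : lp (fun _ : ℕ => 𝕜) 1 →L[𝕜] Z := LinearMap.mkContinuous
    { toFun := fun a => ∑' n, a n • y n
      map_add' := fun a b => by
        rw [← (hsy a).tsum_add (hsy b)]
        simp [add_smul]
      map_smul' := fun c a => by
        rw [RingHom.id_apply, ← (hsy a).tsum_const_smul c]
        simp [mul_smul] } D fun a => by
          rw [hnorm, ← tsum_mul_left]
          refine tsum_of_norm_bounded ((hsum a).mul_left D).hasSum fun n => ?_
          rw [mul_comm]
          exact hle a n
  choose g hg using fun a : lp (fun _ : ℕ => 𝕜) 1 => h a (hsum a)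
  have hgV : ∀ a, J (g a) = V a := hg
  let S : lp (fun _ : ℕ => 𝕜) 1 →ₗ[𝕜] X :=
    { toFun := g
      map_add' := fun a b => hJ (by simp [hgV])
      map_smul' := fun c a => hJ (by simp [hgV]) }
  -- The graph of `S` is closed: `J ∘ S = V` is continuous and `J` is injective and continuous.
  have hS : Continuous S := S.continuous_of_seq_closed_graph fun a a₀ z ha hz => by
    refine hJ (tendsto_nhds_unique ((J.continuous.tendsto z).comp hz) ?_)
    change Tendsto _ _ (𝓝 (J (g a₀)))
    rw [hgV]
    exact ((V.continuous.tendsto a₀).comp ha).congr fun n => (hgV (a n)).symm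
  let S' : lp (fun _ : ℕ => 𝕜) 1 →L[𝕜] X := ⟨S, hS⟩
  refine ⟨‖S'‖, fun n x hx => ?_⟩
  -- The preimage of `y n` is the image of the `n`-th unit vector, which has norm one.
  have hxe : x = S' (lp.single 1 n 1) := hJ (by
    change J x = J (g _)
    rw [hx, hg, tsum_eq_single n fun m hm => by simp [lp.single_apply, hm]]
    simp)
  have h1 := S'.le_opNorm (lp.single 1 n 1)
  rw [lp.norm_single (by simp), norm_one, mul_one] at h1
  rwa [hxe]

theorem tendsto_mul_exp_neg_mul (M : ℝ) {ω : ℝ} (hω : 0 < ω) :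
    Tendsto (fun t : ℝ≥0 => M * Real.exp (-ω * t)) atTop (𝓝 0) := by
  rw [← mul_zero M]
  refine (Real.tendsto_exp_atBot.comp ?_).const_mul M
  exact (NNReal.tendsto_coe_atTop.2 tendsto_id).const_mul_atTop_of_neg (neg_lt_zero.2 hω)

namespace C0Semigroup

variable {𝕜 X : Type*} [RCLike 𝕜] [NormedAddCommGroup X] [NormedSpace 𝕜 X]
variable {U : Type*} [NormedAddCommGroup U] [NormedSpace 𝕜 U]
variable {T : C0Semigroup 𝕜 X} {β : T.generatorResolventSet} {B : U →L[𝕜] T.Extrapolation β}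
  {Φ : ℝ → ℝ}

/-! ### Stability of the semigroup from a `𝒦ℒ` bound -/

theorem norm_op_le_of_forall_norm_le_one {t : ℝ≥0} {C : ℝ} (hC : 0 ≤ C)
    (h : ∀ x : X, ‖x‖ ≤ 1 → ‖T.op t x‖ ≤ C) : ‖T.op t‖ ≤ C :=
  ContinuousLinearMap.opNorm_le_of_unit_norm hC fun x hx => h x hx.le

theorem isExponentiallyStable_of_norm_le {C q : ℝ} {τ : ℝ≥0} (hτ0 : 0 < τ)
    (hC : ∀ t, ‖T.op t‖ ≤ C) (hq0 : 0 < q) (hq : q < 1) (hτ : ‖T.op τ‖ ≤ q) : T.IsExponentiallyStable := by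
  have hC0 : 0 ≤ C := (norm_nonneg _).trans (hC 0)
  have hτR : (0 : ℝ) < τ := hτ0
  have hpow : ∀ (n : ℕ) (t : ℝ≥0), n * τ ≤ t → ‖T.op t‖ ≤ q ^ n * C := by
    intro n
    induction n with
    | zero => simpa using hC
    | succ n ih =>
      intro t ht
      rw [Nat.cast_succ, add_mul, one_mul] at ht
      have h1 := ih (t - τ) (le_tsub_of_add_le_right ht)
      have h2 : T.op t = (T.op τ).comp (T.op (t - τ)) := by
        rw [← T.op_add, add_tsub_cancel_of_le (le_add_self.trans ht)]
      rw [h2, pow_succ', mul_assoc]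
      exact (ContinuousLinearMap.opNorm_comp_le _ _).trans
        (mul_le_mul hτ h1 (norm_nonneg _) hq0.le)
  have hlog : Real.log q < 0 := Real.log_neg hq0 hq
  -- The rate makes `exp (-ω τ) = q`; the factor `q⁻¹` pays for rounding `t / τ` down, and `C + 1`
  -- keeps the constant positive.
  refine ⟨q⁻¹ * (C + 1), -Real.log q / τ, by positivity, div_pos (neg_pos.2 hlog) hτR,
    fun t => ?_⟩
  set n := ⌊(t : ℝ) / τ⌋₊ with hn
  have hnt : n * τ ≤ t := by
    rw [← NNReal.coe_le_coe, NNReal.coe_mul, NNReal.coe_natCast, ← le_div_iff₀ hτR]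
    exact Nat.floor_le (by positivity)
  have hqn : q ^ n ≤ q⁻¹ * Real.exp (-(-Real.log q / τ) * t) := by
    have h1 : q ^ n = Real.exp (n * Real.log q) := by
      rw [Real.exp_nat_mul, Real.exp_log hq0]
    have h2 : q⁻¹ = Real.exp (-Real.log q) := by rw [Real.exp_neg, Real.exp_log hq0]
    rw [h1, h2, ← Real.exp_add, Real.exp_le_exp]
    have h3 : (t : ℝ) / τ < n + 1 := Nat.lt_floor_add_one _
    have h4 : -(-Real.log q / τ) * t = Real.log q * (t / τ) := by
      field_simp
    rw [h4]
    nlinarith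
  calc ‖T.op t‖ ≤ q ^ n * C := hpow n t hnt
    _ ≤ (q⁻¹ * Real.exp (-(-Real.log q / τ) * t)) * (C + 1) := by gcongr; linarith
    _ = _ := by ring

theorem isExponentiallyStable_of_isClassKL {b : ℝ≥0 → ℝ≥0 → ℝ≥0} (hb : IsClassKL b)
    (h : ∀ t x, ‖T.op t x‖₊ ≤ b ‖x‖₊ t) : T.IsExponentiallyStable := by
  have hL := hb.2 1 one_pos
  have hT : ∀ t, ‖T.op t‖ ≤ b 1 t := fun t =>
    norm_op_le_of_forall_norm_le_one (b 1 t).2 fun x hx => by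
      have h1 := (h t x).trans ((hb.1 t).2.2.monotone (show ‖x‖₊ ≤ 1 from hx))
      exact_mod_cast h1
  obtain ⟨τ, hτ, hτ0⟩ := ((hL.2.2.eventually_lt_const
    (show (0 : ℝ≥0) < 2⁻¹ by positivity)).and (eventually_gt_atTop 0)).exists
  refine isExponentiallyStable_of_norm_le (C := b 1 0) (q := 2⁻¹) hτ0
    (fun t => (hT t).trans ?_) (by norm_num) (by norm_num) ((hT τ).trans ?_)
  · exact_mod_cast hL.2.1.antitone bot_le
  · exact_mod_cast hτ.le

/-! ### Admissibility -/

/-- If no bound held, there would be inputs `u n` in the modular unit ball whose responses have norm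
above `n` in `X`. Yet every `ℓ¹` combination of them is an `L_Φ` input, so its response lies in `X`,
and the closed graph argument bounds these norms. -/
theorem exists_uniform_bound_response [CompleteSpace X] [CompleteSpace U] {M : ℝ≥0}
    (hM : ∀ t, ‖T.op t‖ ≤ M) (hΦ : IsYoungFunction Φ) {t : ℝ≥0}
    (hadm : ∀ u : ℝ → U, MemOrliczL Φ t u → ∃ x, T.embed β x = T.response β B u t) :
    ∃ C : ℝ, ∀ u : ℝ → U, AEStronglyMeasurable u (volume.restrict (Ioo (0 : ℝ) t)) →
      orliczModular Φ t 1 u ≤ 1 → ∃ x, T.embed β x = T.response β B u t ∧ ‖x‖ ≤ C := by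
  by_contra! hcon
  choose u hu hu1 hux using fun n : ℕ => hcon n
  obtain ⟨K, hK0, hK⟩ := hΦ.exists_integrable_bound (U := U) t
  have hD : ∀ n, ‖T.response β B (u n) t‖ ≤ M * ‖B‖ * K := fun n => by
    obtain ⟨h1, h2⟩ := hK (u n) (hu n) (hu1 n)
    exact (norm_response_le β B hM h1).trans (by gcongr)
  obtain ⟨C, hC⟩ := exists_bound_of_tsum_mem_range (T.embed β) (T.embed_injective β) hD
    fun a ha => by
      obtain ⟨x, hx⟩ := hadm _ (hΦ.memOrliczL_tsum ha hu hu1)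
      exact ⟨x, hx.trans (response_tsum β B hM hΦ ha hu hu1)⟩
  obtain ⟨n, hn⟩ := exists_nat_gt C
  obtain ⟨x, hx⟩ := hadm (u n) ⟨hu n, 1, one_pos, (hu1 n).trans_lt ENNReal.one_lt_top⟩
  have h1 := hux n x hx
  have h2 := hC n x hx
  linarith

theorem IsExponentiallyStable.exists_norm_le (hT : T.IsExponentiallyStable) :
    ∃ M : ℝ≥0, ∀ t, ‖T.op t‖ ≤ M := by
  obtain ⟨M, ω, hM, hω, h⟩ := hT
  refine ⟨⟨M, hM.le⟩, fun t => (h t).trans ?_⟩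
  refine mul_le_of_le_one_right hM.le (Real.exp_le_one_iff.2 ?_)
  have : 0 ≤ ω * t := by positivity
  linarith

theorem IsExponentiallyStable.exists_norm_le_half (hT : T.IsExponentiallyStable) :
    ∃ τ : ℝ≥0, 0 < τ ∧ ‖T.op τ‖ ≤ 2⁻¹ := by
  obtain ⟨M, ω, hM, hω, h⟩ := hT
  obtain ⟨τ, hτ, hτ0⟩ := (((tendsto_mul_exp_neg_mul M hω).eventually_le_const (show (0 : ℝ) < 2⁻¹ by norm_num)).and
    (eventually_gt_atTop 0)).exists
  exact ⟨τ, hτ0, (h τ).trans hτ⟩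

/-- Fix `τ` with `‖T(τ)‖ ≤ 1/2` and let `C` be the bound for horizon `τ`. Cutting off the last piece
of length `τ` gives the recursion `2C ↦ (1/2) * 2C + C = 2C`, so `2C` serves for all times. -/
theorem exists_uniform_bound_response_of_stable [CompleteSpace X] [CompleteSpace U]
    (hT : T.IsExponentiallyStable) (hΦ : IsYoungFunction Φ)
    (hadm : ∀ (t : ℝ≥0) (u : ℝ → U), MemOrliczL Φ t u →
      ∃ x, T.embed β x = T.response β B u t) :
    ∃ C : ℝ, ∀ (t : ℝ≥0) (u : ℝ → U), AEStronglyMeasurable u (volume.restrict (Ioo (0 : ℝ) t)) →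
      orliczModular Φ t 1 u ≤ 1 → ∃ x, T.embed β x = T.response β B u t ∧ ‖x‖ ≤ C := by
  obtain ⟨M, hM⟩ := hT.exists_norm_le
  obtain ⟨τ, hτ0, hτ⟩ := hT.exists_norm_le_half
  obtain ⟨C, hC⟩ := exists_uniform_bound_response (B := B) hM hΦ (hadm τ)
  have hint : ∀ (t : ℝ≥0) (u : ℝ → U), AEStronglyMeasurable u (volume.restrict (Ioo (0 : ℝ) t)) →
      orliczModular Φ t 1 u ≤ 1 → IntegrableOn u (Ioo (0 : ℝ) t) := fun t u hu hu1 => by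
    obtain ⟨K, -, hK⟩ := hΦ.exists_integrable_bound (U := U) t
    exact (hK u hu hu1).1
  have hshort : ∀ t ≤ τ, ∀ u : ℝ → U, AEStronglyMeasurable u (volume.restrict (Ioo (0 : ℝ) t)) →
      orliczModular Φ t 1 u ≤ 1 → ∃ x, T.embed β x = T.response β B u t ∧ ‖x‖ ≤ C := by
    intro t ht u hu hu1
    -- A horizon shorter than `τ` is reduced to `τ` by resting for the missing time `r`.
    obtain ⟨r, rfl⟩ := exists_add_of_le ht
    rw [add_comm] at hC
    have hd := aestronglyMeasurable_delayedInput (r := r) hu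
    have hd1 := (hΦ.modular_delayedInput r t 1).trans_le hu1
    obtain ⟨x, hx, hxC⟩ := hC _ hd hd1
    exact ⟨x, hx.trans (response_delayedInput β B hM (hint _ _ hd hd1)), hxC⟩
  have hC0 : 0 ≤ C := by
    obtain ⟨x, -, hx⟩ := hC 0 aestronglyMeasurable_const (by simp [orliczModular, hΦ.map_zero])
    exact (norm_nonneg x).trans hx
  have hlong : ∀ (n : ℕ) (t : ℝ≥0), t ≤ n * τ → ∀ u : ℝ → U,
      AEStronglyMeasurable u (volume.restrict (Ioo (0 : ℝ) t)) →
      orliczModular Φ t 1 u ≤ 1 → ∃ x, T.embed β x = T.response β B u t ∧ ‖x‖ ≤ 2 * C := by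
    intro n
    induction n with
    | zero =>
      intro t ht u hu hu1
      rw [Nat.cast_zero, zero_mul] at ht
      obtain ⟨x, hx, hxC⟩ := hshort t (ht.trans bot_le) u hu hu1
      exact ⟨x, hx, by linarith⟩
    | succ n ih =>
      intro t ht u hu hu1
      rcases le_total t τ with htτ | htτ
      · obtain ⟨x, hx, hxC⟩ := hshort t htτ u hu hu1
        exact ⟨x, hx, by linarith⟩
      obtain ⟨r, rfl⟩ := exists_add_of_le htτ
      rw [add_comm τ r] at *
      rw [Nat.cast_succ, add_mul, one_mul, add_le_add_iff_right] at ht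
      obtain ⟨x₁, hx₁, hx₁C⟩ := ih r ht u
        (hu.mono_measure (Measure.restrict_mono_set _ (Ioo_subset_Ioo_right (by simp))))
        ((orliczModular_mono le_self_add 1).trans hu1)
      obtain ⟨x₂, hx₂, hx₂C⟩ := hC _ (aestronglyMeasurable_shift hu)
        ((orliczModular_shift_le r τ 1).trans hu1)
      refine ⟨T.op τ x₁ + x₂, ?_, ?_⟩
      · rw [response_add β B hM (hint _ _ hu hu1), map_add, ← extrapolatedOp_embed, hx₁, hx₂]
      · have h1 : ‖T.op τ x₁‖ ≤ 2⁻¹ * (2 * C) :=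
          ((T.op τ).le_opNorm x₁).trans (mul_le_mul hτ hx₁C (norm_nonneg _) (by norm_num))
        linarith [norm_add_le (T.op τ x₁) x₂]
  refine ⟨2 * C, fun t => ?_⟩
  obtain ⟨n, hn⟩ := exists_nat_ge (t / τ)
  exact hlong n t ((div_le_iff₀ hτ0).1 hn)

/-! ### The implications between the stability notions -/

theorem isOrliczISS_of_stable [CompleteSpace X] [CompleteSpace U]
    (hT : T.IsExponentiallyStable) (hΦ : IsYoungFunction Φ)
    (hadm : ∀ (t : ℝ≥0) (u : ℝ → U), MemOrliczL Φ t u →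
      ∃ x, T.embed β x = T.response β B u t) :
    T.IsOrliczISS β B Φ := by
  obtain ⟨C, hC⟩ := exists_uniform_bound_response_of_stable hT hΦ hadm
  obtain ⟨M₀, hM₀⟩ := hT.exists_norm_le
  obtain ⟨M, ω, hM, hω, hTM⟩ := hT
  have hC1 : 0 < |C| + 1 := by positivity
  have hresp : ∀ (t : ℝ≥0) (u : ℝ → U), MemOrliczL Φ t u →
      ∃ x, T.embed β x = T.response β B u t ∧ ‖x‖ ≤ (|C| + 1) * luxemburgNorm Φ t u := by
    intro t u hu
    obtain ⟨x, hx⟩ := hadm t u hu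
    refine ⟨x, hx, hΦ.le_mul_luxemburgNorm hu hC1 fun k hk hk1 => ?_⟩
    -- Scaling by `k⁻¹` moves `u` into the modular unit ball; injectivity of the embedding then
    -- identifies `x` with `k • y`.
    rw [← orliczModular_one_smul (𝕜 := 𝕜) hk] at hk1
    have hku := hu.1.const_smul ((k : 𝕜)⁻¹)
    obtain ⟨y, hy, hyC⟩ := hC t _ hku hk1
    obtain ⟨K, -, hK⟩ := hΦ.exists_integrable_bound (U := U) t
    have hkne : (k : 𝕜) ≠ 0 := by exact_mod_cast hk.ne'
    have hxy : x = (k : 𝕜) • y := T.embed_injective β (by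
      rw [map_smul, hy, hx, ← response_smul β B hM₀ _ (hK _ hku hk1).1, smul_inv_smul₀ hkne])
    rw [hxy, norm_smul, RCLike.norm_ofReal, abs_of_pos hk, mul_comm]
    gcongr
    linarith [le_abs_self C]
  set E : ℝ≥0 → ℝ≥0 := fun t => ⟨M * Real.exp (-ω * t), by positivity⟩ with hE
  have hE0 : ∀ t, 0 < E t := fun t => by
    rw [← NNReal.coe_pos]
    exact mul_pos hM (Real.exp_pos _)
  have hEc : Continuous E := by
    refine Continuous.subtype_mk ?_ _
    fun_prop
  have hEa : StrictAnti E := fun s t hst => by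
    rw [← NNReal.coe_lt_coe]
    refine mul_lt_mul_of_pos_left (Real.exp_lt_exp.2 ?_) hM
    rw [neg_mul, neg_mul, neg_lt_neg_iff]
    exact mul_lt_mul_of_pos_left hst hω
  have hEl : Tendsto E atTop (𝓝 0) := by
    rw [← NNReal.tendsto_coe]
    exact tendsto_mul_exp_neg_mul M hω
  set C' : ℝ≥0 := ⟨|C| + 1, hC1.le⟩ with hC'
  have hC'0 : 0 < C' := hC1
  refine ⟨fun s t => s * E t, fun r => C' * r, ⟨fun t => ⟨zero_mul _,
      continuous_id.mul continuous_const, fun s s' h => mul_lt_mul_of_pos_right h (hE0 t)⟩,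
    fun s hs => ⟨continuous_const.mul hEc, fun t t' h => mul_lt_mul_of_pos_left (hEa h) hs, by
      simpa using hEl.const_mul s⟩⟩, ⟨⟨mul_zero _, continuous_const.mul continuous_id,
      fun s s' h => mul_lt_mul_of_pos_left h hC'0⟩, tendsto_id.const_mul_atTop hC'0⟩,
    fun t x₀ u hu => ?_⟩
  obtain ⟨x, hx, hxle⟩ := hresp t u hu.1
  refine ⟨T.op t x₀ + x, by rw [mildSolution_eq, map_add, hx], ?_⟩
  rw [← NNReal.coe_le_coe]
  refine (norm_add_le _ _).trans (add_le_add ?_ hxle)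
  exact ((T.op t).le_of_opNorm_le (hTM t) x₀).trans_eq (mul_comm _ _)

theorem IsOrliczISS.isOrliczIISS (hΦ : IsYoungFunction Φ) (hΔ : SatisfiesDeltaTwo Φ)
    (h : T.IsOrliczISS β B Φ) : T.IsOrliczIISS β B Φ := by
  obtain ⟨b, μ, hb, hμ, hest⟩ := h
  obtain ⟨θ, hθ, hle⟩ := hΦ.exists_luxemburgNorm_le (U := U) hΔ
  refine ⟨b, μ ∘ θ, youngGauge Φ, hb, ⟨⟨?_, hμ.1.2.1.comp hθ.1.2.1, hμ.1.2.2.comp hθ.1.2.2⟩,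
    hμ.2.comp hθ.2⟩, hΦ.isClassK_youngGauge, fun t x₀ u hu => ?_⟩
  · simp [hθ.1.1, hμ.1.1]
  · obtain ⟨x, hx, hxle⟩ := hest t x₀ u hu
    exact ⟨x, hx, fun hfin => hxle.trans
      (add_le_add_right (hμ.1.2.2.monotone (hle t u hfin)) _)⟩

theorem IsOrliczIISS.isOrliczUBEBS (h : T.IsOrliczIISS β B Φ) : T.IsOrliczUBEBS β B Φ := by
  obtain ⟨b, θ, μ, hb, hθ, hμ, hest⟩ := h
  have hb0 := hb.1 0
  -- The summand `s` is needed because `b s 0` is only of class `𝒦` in `s` and may be bounded.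
  refine ⟨fun s => s + b s 0, θ, μ, 1, ⟨⟨by simp [hb0.1], continuous_id.add hb0.2.1,
    strictMono_id.add hb0.2.2⟩, tendsto_atTop_mono (fun s => le_self_add) tendsto_id⟩,
    hθ, hμ, one_pos, fun t x₀ u hu => ?_⟩
  obtain ⟨x, hx, hxle⟩ := hest t x₀ u hu
  refine ⟨x, hx, fun hfin => (hxle hfin).trans ?_⟩
  have hbt : b ‖x₀‖₊ t ≤ b ‖x₀‖₊ 0 := by
    -- Decrease in time is part of the definition of `𝒦ℒ` only for positive first argument; at `0`
    -- both sides vanish.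
    rcases eq_or_ne ‖x₀‖₊ 0 with h0 | h0
    · simp [h0, (hb.1 t).1]
    · exact (hb.2 _ (pos_iff_ne_zero.2 h0)).2.1.antitone bot_le
  calc _ ≤ b ‖x₀‖₊ 0 + θ _ := add_le_add_left hbt _
    _ ≤ ‖x₀‖₊ + b ‖x₀‖₊ 0 + θ _ := add_le_add_left le_add_self _
    _ ≤ _ := le_self_add

theorem IsOrliczIISS.isExponentiallyStable (hΦ : IsYoungFunction Φ)
    (h : T.IsOrliczIISS β B Φ) : T.IsExponentiallyStable := by
  obtain ⟨b, θ, μ, hb, hθ, hμ, hest⟩ := h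
  refine isExponentiallyStable_of_isClassKL hb fun t x => ?_
  obtain ⟨y, hy, hyle⟩ := hest t x 0 (hΦ.memOrliczE_zero t).1
  rw [mildSolution_eq, response_zero, add_zero] at hy
  rw [← T.embed_injective β hy]
  simpa [hμ.1, hθ.1.1] using hyle

/-- What matters is that the mild solution from the zero state lies in `X` for every `L_Φ` input,
also where the energy integral is infinite; the quantitative bound is recovered from the closed
graph theorem. -/
theorem IsOrliczUBEBS.isOrliczISS [CompleteSpace X] [CompleteSpace U] (hΦ : IsYoungFunction Φ)
    (hΔ : SatisfiesDeltaTwo Φ) (h : T.IsOrliczUBEBS β B Φ) (hT : T.IsExponentiallyStable) :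
    T.IsOrliczISS β B Φ := by
  obtain ⟨γ, θ, μ, c, -, -, -, -, hest⟩ := h
  refine isOrliczISS_of_stable hT hΦ fun t u hu => ?_
  obtain ⟨x, hx, -⟩ := hest t 0 u (hu.memOrliczE hΦ hΔ)
  rw [mildSolution_eq, map_zero, map_zero, zero_add] at hx
  exact ⟨x, hx⟩

end C0Semigroup

theorem mainTheorem2 {𝕜 X U : Type*} [RCLike 𝕜]
    [NormedAddCommGroup X] [NormedSpace 𝕜 X] [CompleteSpace X]
    [NormedAddCommGroup U] [NormedSpace 𝕜 U] [CompleteSpace U]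
    (T : C0Semigroup 𝕜 X) (β : T.generatorResolventSet) (B : U →L[𝕜] T.Extrapolation β)
    (Φ : ℝ → ℝ) (hΦ : IsYoungFunction Φ) (hΔ : SatisfiesDeltaTwo Φ) :
    List.TFAE
      [T.IsOrliczISS β B Φ,
        T.IsOrliczIISS β B Φ,
        T.IsOrliczUBEBS β B Φ ∧ T.IsExponentiallyStable] := by
  tfae_have 1 → 2 := fun h => h.isOrliczIISS hΦ hΔ
  tfae_have 2 → 3 := fun h => ⟨h.isOrliczUBEBS, h.isExponentiallyStable hΦ⟩
  tfae_have 3 → 1 := fun h => h.1.isOrliczISS hΦ hΔ h.2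
  tfae_finish
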